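/- Let $n\ge 0$ and $k\ge 1$ be integers, and let $\alpha,\beta$ be partitions with $|\alpha|=|\beta|$, $\beta_1\le k$ and $\ell(\alpha)+\ell(\beta)\le n+1$. Put $r=\ell(\alpha)$, $s=\ell(\beta)$, and let $[\alpha,\beta]^k_{n+1}$ be the partition $$(\alpha_1+k,\dots,\alpha_r+k,\,k,\dots,k,\,k-\beta_s,\dots,k-\beta_1)$$ with $n+1$ (possibly zero) parts. All tableaux are semistandard, over the alphabet $a_1<\dots<a_{n+1}$; $\mathrm{Tab}(\lambda,(k^{n+1}))$ is the set of tableaux of shape $\lambda$ in which each letter occurs exactly $k$ times. For $1\le i\le n$ and a word $w$, take the subword of the letters $a_i,a_{i+1}$ of $w$ and bracket (remove) repeatedly all factors $a_{i+1}a_i$; a subword $a_i^p a_{i+1}^q$ of free letters remains. The operator $\epsilon_i$ replaces it in $w$ by $a_i^{p+1}a_{i+1}^{q-1}$ (and $\epsilon_i(w)=0$ if $q=0$); $\phi_i$ replaces it by $a_i^{p-1}a_{i+1}^{q+1}$ (and $\phi_i(w)=0$ if $p=0$). The exponent of a tableau $t$ in direction $i$ is $$d_i(t)=\min\{\max\{m:\epsilon_i^m(w_t)\ne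 0\},\ \max\{m:\phi_i^m(w_t)\neq 0\}\},$$ where $w_t$ is the column reading word of $t$ (columns from left to right, each read from its largest to its smallest entry). Put $$\mathbf K_{\lambda,(k^{n+1})}(x_1,\dots,x_n)=\sum_{t\in \mathrm{Tab}(\lambda,(k^{n+1}))}\ \prod_{i=1}^n x_i^{d_i(t)}.$$ Let $s_\nu(x_1,\dots,x_n)$ denote the Schur polynomial. Then: (i) If $\alpha=(m)$ is a row, then $\mathbf K_{[(m),\beta]^k_{n+1},(k^{n+1})}(x_1,\dots,x_n)=s_\beta(x_1,\dots,x_n)$. (ii) If $\beta=(m)$ is a row, then $\mathbf K_{[\alpha,(m)]^k_{n+1},(k^{n+1})}(x_1,\dots,x_n)=s_\alpha(x_1,\dots,x_n)$. (iii) If $k\ge\max(\alpha_1,\beta_1)$, then $$\mathbf K_{[\alpha,\beta]^k_{n+1},(k^{n+1})}(x_1,\dots,x_n)=\mathbf K_{[\beta,\alpha]^k_{n+1},(k^{n+1})}(x_1,\dots,x_n).$$ Moreover, replacing the first $2k$ columns $C_1,\dots,C_{2k}$ (empty ones included) of a tableau by the complements of $C_{2k},\dots,C_1$ in the alphabet,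 in this order, defines mutually inverse bijections between $\mathrm{Tab}([\alpha,\beta]^k_{n+1},(k^{n+1}))$ and $\mathrm{Tab}([\beta,\alpha]^k_{n+1},(k^{n+1}))$, and these preserve all the exponents $d_1,\dots,d_n$. -/

import Mathlib

/-!
Partitions are Young diagrams: `α.rowLen i` is the part `α_{i+1}`, `α.colLen 0` is the length,
and `α.card` is the weight `|α|`. The letter `a_{i+1}` of the alphabet `a_1 < ... < a_{n+1}` is the
natural number `i`, and the direction `i + 1` and the variable `x_{i+1}` are indexed by `i : Fin n`.
-/

namespace GenExp

/-! ### Crystal operators on words -/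

/-- One step of the bracketing procedure, for the subword of letters `i`, `i + 1`. The elements of
the list are pairs (letter, position); `st` holds the letters read so far that are not yet
bracketed, the last one first. A letter `i` that meets an unbracketed `i + 1` immediately to its
left is bracketed with it, and both are removed. -/
def bracketStep (i : ℕ) : List (ℕ × ℕ) → ℕ × ℕ → List (ℕ × ℕ)
  | [], x => [x]
  | y :: st, x => if y.1 = i + 1 ∧ x.1 = i then st else x :: y :: st

/-- The letters `i`, `i + 1` of `w`, with their positions in `w`, which stay free after all factors
`(i + 1) i` have been bracketed repeatedly. They form a word `i ^ r (i + 1) ^ s`. -/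
def freeLetters (i : ℕ) (w : List ℕ) : List (ℕ × ℕ) :=
  ((w.zipIdx.filter fun x => x.1 = i ∨ x.1 = i + 1).foldl (bracketStep i) []).reverse

/-- The operator `ε_i`: it replaces the free subword `i ^ r (i + 1) ^ s` by
`i ^ (r + 1) (i + 1) ^ (s - 1)`, and yields `none` (that is, zero) when `s = 0`. -/
def epsilonOp (i : ℕ) (w : List ℕ) : Option (List ℕ) :=
  ((freeLetters i w).find? fun x => x.1 = i + 1).map fun x => w.set x.2 i

/-- The operator `φ_i`: it replaces the free subword `i ^ r (i + 1) ^ s` by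
`i ^ (r - 1) (i + 1) ^ (s + 1)`, and yields `none` (that is, zero) when `r = 0`. -/
def phiOp (i : ℕ) (w : List ℕ) : Option (List ℕ) :=
  ((freeLetters i w).reverse.find? fun x => x.1 = i).map fun x => w.set x.2 (i + 1)

/-- The `m`-th power of a partially defined operator, applied to `w`. -/
def iterOp (f : List ℕ → Option (List ℕ)) (m : ℕ) (w : List ℕ) : Option (List ℕ) :=
  (fun o => o.bind f)^[m] (some w)

/-- `max {m | f ^ m (w) ≠ 0}`. -/
noncomputable def maxPower (f : List ℕ → Option (List ℕ)) (w : List ℕ) : ℕ :=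
  sSup {m : ℕ | iterOp f m w ≠ none}

/-! ### Tableaux -/

/-- The column reading of a tableau: columns from left to right, each of them from its largest
entry to its smallest one. It represents the tableau in the plactic monoid. -/
def columnWord {lam : YoungDiagram} (T : SemistandardYoungTableau lam) : List ℕ :=
  (List.range (lam.rowLen 0)).flatMap fun j =>
    ((List.range (lam.colLen j)).map fun i => T i j).reverse

/-- The exponent of the tableau `T` in direction `i`: the distance from `T` to the nearest end of
its string of colour `i` in the crystal graph. -/
noncomputable def exponent {lam : YoungDiagram} (T : SemistandardYoungTableau lam) (i : ℕ) : ℕ :=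
  min (maxPower (epsilonOp i) (columnWord T)) (maxPower (phiOp i) (columnWord T))

/-- The number of occurrences of the letter `a` in the tableau `T`. -/
def mult {lam : YoungDiagram} (T : SemistandardYoungTableau lam) (a : ℕ) : ℕ :=
  (lam.cells.filter fun c => T c.1 c.2 = a).card

/-- Semistandard tableaux of shape `lam` over the alphabet `{0, ..., N - 1}`. -/
def BoundedTab (lam : YoungDiagram) (N : ℕ) : Type :=
  {T : SemistandardYoungTableau lam // ∀ c ∈ lam.cells, T c.1 c.2 < N}

/-- Semistandard tableaux of shape `lam` and weight `wt`, over the alphabet `{0, ..., N - 1}`. -/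
def Tab (lam : YoungDiagram) {N : ℕ} (wt : Fin N → ℕ) : Type :=
  {T : SemistandardYoungTableau lam //
    (∀ c ∈ lam.cells, T c.1 c.2 < N) ∧ ∀ a : Fin N, mult T a = wt a}

instance finite_boundedTab (lam : YoungDiagram) (N : ℕ) : Finite (BoundedTab lam N) := by
  refine Finite.of_injective
    (fun T (c : lam.cells) => (⟨T.1 c.1.1 c.1.2, T.2 c.1 c.2⟩ : Fin N)) ?_
  intro T T' h
  apply Subtype.ext
  ext i j
  by_cases hc : (i, j) ∈ lam
  · have h1 := congrFun h ⟨(i, j), (YoungDiagram.mem_cells _).2 hc⟩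
    exact congrArg Fin.val h1
  · rw [T.1.zeros hc, T'.1.zeros hc]

instance finite_tab (lam : YoungDiagram) {N : ℕ} (wt : Fin N → ℕ) : Finite (Tab lam wt) :=
  Finite.of_injective (β := BoundedTab lam N) (fun T => ⟨T.1, T.2.1⟩) fun _ _ h =>
    Subtype.ext (congrArg (fun S : BoundedTab lam N => S.1) h)

noncomputable instance fintype_boundedTab (lam : YoungDiagram) (N : ℕ) :
    Fintype (BoundedTab lam N) :=
  Fintype.ofFinite _

noncomputable instance fintype_tab (lam : YoungDiagram) {N : ℕ} (wt : Fin N → ℕ) :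
    Fintype (Tab lam wt) :=
  Fintype.ofFinite _

/-! ### The polynomials -/

/-- The Schur polynomial `s_β(x_1, ..., x_n)`. -/
noncomputable def schur (n : ℕ) (β : YoungDiagram) : MvPolynomial (Fin n) ℤ :=
  ∑ T : BoundedTab β n, ∏ i : Fin n, MvPolynomial.X i ^ mult T.1 i

/-- The tableaux of shape `lam` and rectangular weight `(k ^ (n + 1))`. -/
abbrev RectTab (n k : ℕ) (lam : YoungDiagram) : Type :=
  Tab lam (fun _ : Fin (n + 1) => k)

/-- The polynomial `K_{lam, (k ^ (n + 1))}(x_1, ..., x_n)` refining the generating function of the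
generalized exponents. -/
noncomputable def genExpPoly (n k : ℕ) (lam : YoungDiagram) : MvPolynomial (Fin n) ℤ :=
  ∑ T : RectTab n k lam, ∏ i : Fin n, MvPolynomial.X i ^ exponent T.1 i

/-! ### The shapes -/

/-- The one-row partition `(m)`. -/
def rowPartition (m : ℕ) : YoungDiagram where
  cells := {0} ×ˢ Finset.range m
  isLowerSet := by
    rintro ⟨i, j⟩ ⟨i', j'⟩ h hc
    simp only [Prod.mk_le_mk] at h
    simp only [Finset.coe_product, Set.mem_prod, Finset.mem_coe, Finset.mem_singleton,
      Finset.mem_range] at hc ⊢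
    omega

/-- The partition `[α, β]^k_{n+1}`, whose parts are `k + α_i - β_{n+2-i}` for `1 ≤ i ≤ n + 1`.
When the lengths of `α` and `β` add up to at most `n + 1`, these are `α_1 + k, ..., α_r + k`, then
`k, ..., k`, then `k - β_s, ..., k - β_1`; see `rowLen_pairShape_top` and the lemmas after it. -/
def pairShape (n k : ℕ) (α β : YoungDiagram) : YoungDiagram where
  cells := (Finset.range (n + 1)).sigma
      (fun i => Finset.range (k + α.rowLen i - β.rowLen (n - i)))
    |>.map (Equiv.sigmaEquivProd ℕ ℕ).toEmbedding
  isLowerSet := by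
    rintro ⟨i, j⟩ ⟨i', j'⟩ h hc
    simp only [Prod.mk_le_mk] at h
    have h1 := α.rowLen_anti i' i h.1
    have h2 := β.rowLen_anti (n - i) (n - i') (by omega)
    simp only [Finset.coe_map, Set.mem_image, Finset.mem_coe, Finset.mem_sigma,
      Finset.mem_range, Equiv.coe_toEmbedding] at hc ⊢
    obtain ⟨⟨a, b⟩, hab, he⟩ := hc
    simp only [Equiv.sigmaEquivProd_apply, Prod.mk.injEq] at he
    obtain ⟨rfl, rfl⟩ := he
    exact ⟨⟨i', j'⟩, by dsimp only at hab ⊢; omega, rfl⟩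

theorem mem_pairShape {n k : ℕ} {α β : YoungDiagram} {i j : ℕ} :
    (i, j) ∈ pairShape n k α β ↔ i ≤ n ∧ j < k + α.rowLen i - β.rowLen (n - i) := by
  rw [← YoungDiagram.mem_cells]
  simp only [pairShape, Finset.mem_map, Finset.mem_sigma, Finset.mem_range,
    Equiv.coe_toEmbedding]
  constructor
  · rintro ⟨⟨a, b⟩, hab, he⟩
    simp only [Equiv.sigmaEquivProd_apply, Prod.mk.injEq] at he
    obtain ⟨rfl, rfl⟩ := he
    exact ⟨Nat.lt_succ_iff.1 hab.1, hab.2⟩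
  · intro h
    exact ⟨⟨i, j⟩, ⟨Nat.lt_succ_iff.2 h.1, h.2⟩, rfl⟩

theorem rowLen_pairShape {n k : ℕ} {α β : YoungDiagram} {i : ℕ} (hi : i ≤ n) :
    (pairShape n k α β).rowLen i = k + α.rowLen i - β.rowLen (n - i) := by
  refine eq_of_forall_lt_iff fun j => ?_
  rw [← YoungDiagram.mem_iff_lt_rowLen, mem_pairShape]
  exact ⟨fun h => h.2, fun h => ⟨hi, h⟩⟩

theorem rowLen_eq_zero {α : YoungDiagram} {i : ℕ} (h : α.colLen 0 ≤ i) : α.rowLen i = 0 := by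
  by_contra hne
  have h1 : (i, 0) ∈ α := YoungDiagram.mem_iff_lt_rowLen.2 (Nat.pos_of_ne_zero hne)
  have h2 := YoungDiagram.mem_iff_lt_colLen.1 h1
  omega

theorem rowLen_pairShape_top {n k : ℕ} {α β : YoungDiagram}
    (hlen : α.colLen 0 + β.colLen 0 ≤ n + 1) {i : ℕ} (hi : i < α.colLen 0) :
    (pairShape n k α β).rowLen i = α.rowLen i + k := by
  rw [rowLen_pairShape (by omega), rowLen_eq_zero (α := β) (by omega)]
  omega

theorem rowLen_pairShape_middle {n k : ℕ} {α β : YoungDiagram} {i : ℕ}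
    (hi : α.colLen 0 ≤ i) (hi' : i + β.colLen 0 < n + 1) :
    (pairShape n k α β).rowLen i = k := by
  rw [rowLen_pairShape (by omega), rowLen_eq_zero (α := β) (by omega), rowLen_eq_zero hi]
  omega

theorem rowLen_pairShape_bottom {n k : ℕ} {α β : YoungDiagram}
    (hlen : α.colLen 0 + β.colLen 0 ≤ n + 1) {j : ℕ} (hj : j < β.colLen 0) :
    (pairShape n k α β).rowLen (n - j) = k - β.rowLen j := by
  rw [rowLen_pairShape (by omega), rowLen_eq_zero (α := α) (by omega)]
  congr 2
  omega

/-! ### Complementing columns -/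

/-- The set of entries of column `j` of a tableau (empty for a column outside the shape). -/
def columnSet {lam : YoungDiagram} (T : SemistandardYoungTableau lam) (j : ℕ) : Finset ℕ :=
  (Finset.range (lam.colLen j)).image fun i => T i j

/-- `T'` is obtained from `T` by replacing each of the first `2 * k` columns (empty ones included)
by its complement in the alphabet `{0, ..., n}`, and reversing the order of these columns. -/
def IsColumnComplement (n k : ℕ) {lam lam' : YoungDiagram}
    (T : SemistandardYoungTableau lam) (T' : SemistandardYoungTableau lam') : Prop :=
  ∀ j < 2 * k, columnSet T' j = Finset.range (n + 1) \ columnSet T (2 * k - 1 - j)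

end GenExp

namespace GenExp

/-! ### Free letters and the bicyclic monoid -/

/-! Bracketing is multiplication in the bicyclic monoid: a word reduces to a pair `(p, q)` counting
its free letters `i` and `i + 1`. Each `ε_i` lowers `q` by one and each `φ_i` lowers `p` by one, so
`d_i = min p q` (`exponent_eq_min`). In a column reading, a column contributes only when it contains
exactly one of `i`, `i + 1`. Bracketing preserves the difference of the two multiplicities, so in
rectangular weight `d_i = p = q` (`exponent_rectTab`).

Complementing a column exchanges its two possible contributions, and exchange combined with reversal
is an anti-automorphism of the monoid. Complementing and reversing the first `2 * k` columns
therefore exchanges `p` and `q`, which are equal; this gives (iii). The row condition on adjacent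
columns is expressed by counting letters below each bound (`IsColumns`), a form that behaves well
under complements.

For (i), the least letter fills the top of the first `k` columns. Their complements in reverse
order, with letters lowered by one, form a tableau `U` of shape `β` on `n` letters. The remaining
columns form a row whose content is the content of `U` raised by one, so `T ↦ U` is a bijection. A
bound on the free letters shows that `d_i` is the multiplicity of `i` in `U`
(`exponent_eq_mult_peelTab`), so the sum becomes the Schur polynomial. Part (ii) follows from (i)
through the complement bijection, because `α_1 ≤ |α| = m ≤ k`. -/

/-- The product of the bicyclic monoid: `(p, q)` stands for the word `i ^ p (i + 1) ^ q` in which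
the factors `(i + 1) i` are removed. -/
def bicyclicMul (x y : ℕ × ℕ) : ℕ × ℕ := (x.1 + (y.1 - x.2), y.2 + (x.2 - y.1))

theorem bicyclicMul_assoc (x y z : ℕ × ℕ) :
    bicyclicMul (bicyclicMul x y) z = bicyclicMul x (bicyclicMul y z) := by
  simp only [bicyclicMul, Prod.mk.injEq]
  omega

@[simp] theorem bicyclicMul_zero (x : ℕ × ℕ) : bicyclicMul x (0, 0) = x := by
  simp [bicyclicMul]

@[simp] theorem zero_bicyclicMul (x : ℕ × ℕ) : bicyclicMul (0, 0) x = x := by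
  simp [bicyclicMul]

/-- This anti-automorphism is the source of the duality between a sequence of columns and its
reversed complements. -/
theorem swap_bicyclicMul (x y : ℕ × ℕ) :
    (bicyclicMul x y).swap = bicyclicMul y.swap x.swap := rfl

/-- The product of a list in the bicyclic monoid. -/
def bicyclicProd : List (ℕ × ℕ) → ℕ × ℕ
  | [] => (0, 0)
  | x :: l => bicyclicMul x (bicyclicProd l)

theorem bicyclicProd_append (l l' : List (ℕ × ℕ)) :
    bicyclicProd (l ++ l') = bicyclicMul (bicyclicProd l) (bicyclicProd l') := by
  induction l with
  | nil => simp [bicyclicProd]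
  | cons x l ih => simp [bicyclicProd, ih, bicyclicMul_assoc]

theorem bicyclicProd_map_swap_reverse (l : List (ℕ × ℕ)) :
    bicyclicProd (l.map Prod.swap).reverse = (bicyclicProd l).swap := by
  induction l with
  | nil => rfl
  | cons x l ih => simp [bicyclicProd_append, bicyclicProd, ih, swap_bicyclicMul]

theorem bicyclicProd_eq_zero {l : List (ℕ × ℕ)} (h : ∀ x ∈ l, x = (0, 0)) :
    bicyclicProd l = (0, 0) := by
  induction l with
  | nil => rfl
  | cons x l ih =>
    simp only [List.mem_cons, forall_eq_or_imp] at h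
    simp [bicyclicProd, h.1, ih h.2]

/-- The class of a letter in the bicyclic monoid. -/
def letterState (i a : ℕ) : ℕ × ℕ :=
  if a = i then (1, 0) else if a = i + 1 then (0, 1) else (0, 0)

/-- The numbers of free letters `i` and of free letters `i + 1` in a word. -/
def wordState (i : ℕ) (w : List ℕ) : ℕ × ℕ := bicyclicProd (w.map (letterState i))

theorem wordState_append (i : ℕ) (u v : List ℕ) :
    wordState i (u ++ v) = bicyclicMul (wordState i u) (wordState i v) := by
  simp [wordState, bicyclicProd_append]

theorem wordState_cons (i a : ℕ) (w : List ℕ) :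
    wordState i (a :: w) = bicyclicMul (letterState i a) (wordState i w) := rfl

theorem wordState_flatMap {ι : Type*} (i : ℕ) (l : List ι) (f : ι → List ℕ) :
    wordState i (l.flatMap f) = bicyclicProd (l.map fun j => wordState i (f j)) := by
  induction l with
  | nil => rfl
  | cons x l ih => simp [wordState_append, bicyclicProd, ih]

/-- The stack of the letters, with their positions, that are free in `w`. -/
def freeStack (i : ℕ) (w : List ℕ) : List (ℕ × ℕ) :=
  (w.zipIdx.filter fun x => x.1 = i ∨ x.1 = i + 1).foldl (bracketStep i) []

theorem freeStack_append_singleton (i : ℕ) (w : List ℕ) (a : ℕ) :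
    freeStack i (w ++ [a]) =
      if a = i ∨ a = i + 1 then bracketStep i (freeStack i w) (a, w.length)
      else freeStack i w := by
  unfold freeStack
  rw [List.zipIdx_append, List.filter_append, List.foldl_append]
  by_cases h : a = i ∨ a = i + 1 <;> simp [h]

/-- The link between the concrete bracketing and the monoid. The stack has its latest letter on top,
so the free word appears reversed. Induction is on the last letter, the one that the fold treats
last. -/
theorem freeStack_letters (i : ℕ) (w : List ℕ) :
    (freeStack i w).map Prod.fst =
      List.replicate (wordState i w).2 (i + 1) ++ List.replicate (wordState i w).1 i := by
  induction w using List.reverseRecOn with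
  | nil => rfl
  | append_singleton w a ih =>
    rw [freeStack_append_singleton, wordState_append]
    generalize hs : wordState i w = s at ih ⊢
    obtain ⟨p, q⟩ := s
    have hone : wordState i [a] = letterState i a := by simp [wordState, bicyclicProd]
    rw [hone]
    generalize freeStack i w = st at ih ⊢
    by_cases h : a = i
    · subst h
      rcases st with _ | ⟨y, st⟩
      · have h1 := congrArg List.length ih
        simp only [List.map_nil, List.length_nil, List.length_append, List.length_replicate] at h1
        obtain ⟨rfl, rfl⟩ : p = 0 ∧ q = 0 := by omega
        simp [letterState, bicyclicMul, bracketStep]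
      · rcases q with _ | q
        -- With `q = 0` the stack holds only letters `a`, so a further `a` has nothing to cancel.
        · have hy : y.1 ≠ a + 1 := by
            rcases p with _ | p
            · simp at ih
            · simp [List.replicate_succ] at ih
              omega
          simp [letterState, bicyclicMul, bracketStep, hy] at ih ⊢
          rw [ih, List.replicate_succ]
        · simp [List.replicate_succ] at ih
          simp [letterState, bicyclicMul, bracketStep, ih.1]
          simpa using ih.2
    · by_cases h' : a = i + 1
      · subst h'
        have : bracketStep i st (i + 1, w.length) = (i + 1, w.length) :: st := by
          rcases st with _ | ⟨y, st⟩ <;> simp [bracketStep]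
        simp [this, letterState, bicyclicMul, ih, add_comm 1 q, List.replicate_succ]
      · simp [h, h', letterState, ih]

theorem freeStack_pairwise (i : ℕ) (w : List ℕ) :
    (freeStack i w).Pairwise fun x y => y.1 ≤ x.1 := by
  have h : ((freeStack i w).map Prod.fst).Pairwise fun x y => y ≤ x := by
    rw [freeStack_letters, List.pairwise_append]
    refine ⟨by simp [List.pairwise_replicate], by simp [List.pairwise_replicate], ?_⟩
    intro a ha b hb
    rw [List.eq_of_mem_replicate ha, List.eq_of_mem_replicate hb]
    omega
  rwa [List.pairwise_map] at h

theorem freeStack_mem {i : ℕ} {w : List ℕ} {x : ℕ × ℕ} (hx : x ∈ freeStack i w) :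
    x.1 = i ∨ x.1 = i + 1 := by
  have h := List.mem_map_of_mem (f := Prod.fst) hx
  rw [freeStack_letters, List.mem_append] at h
  rcases h with h | h
  · exact Or.inr (List.eq_of_mem_replicate h)
  · exact Or.inl (List.eq_of_mem_replicate h)

theorem freeStack_count (i : ℕ) (w : List ℕ) :
    wordState i w = (((freeStack i w).map Prod.fst).count i,
      ((freeStack i w).map Prod.fst).count (i + 1)) := by
  simp [freeStack_letters, List.count_replicate]

theorem bracketStep_cases {i a l : ℕ} (st : List (ℕ × ℕ)) :
    (∃ y st', st = y :: st' ∧ y.1 = i + 1 ∧ a = i ∧ bracketStep i st (a, l) = st') ∨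
    ((∀ y st', st = y :: st' → ¬(y.1 = i + 1 ∧ a = i)) ∧
      bracketStep i st (a, l) = (a, l) :: st) := by
  rcases st with _ | ⟨y, st⟩
  · right
    simp [bracketStep]
  · by_cases h : y.1 = i + 1 ∧ a = i
    · left
      exact ⟨y, st, rfl, h.1, h.2, by simp [bracketStep, h]⟩
    · right
      refine ⟨?_, by simp only [bracketStep, if_neg h]⟩
      rintro _ _ ⟨⟩
      exact h

/-- A free letter splits the word in two, whose free letters are those before and after it. -/
theorem freeStack_split {i : ℕ} {w : List ℕ} {A B : List (ℕ × ℕ)} {c x : ℕ}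
    (h : freeStack i w = A ++ (c, x) :: B) :
    ∃ u v, w = u ++ c :: v ∧ u.length = x ∧ freeStack i u = B ∧
      (freeStack i v).map Prod.fst = A.map Prod.fst := by
  induction w using List.reverseRecOn generalizing A with
  | nil => simp [freeStack] at h
  | append_singleton w a ih =>
    rw [freeStack_append_singleton] at h
    split_ifs at h with ha
    · rcases bracketStep_cases (i := i) (a := a) (l := w.length) (freeStack i w) with
        ⟨y, st', h1, h2, h3, h4⟩ | ⟨h1, h2⟩
      · rw [h4] at h
        subst h
        -- The last letter cancels the top `y`, so before it the stack above the chosen letter was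
        -- `y :: A`. Positions in `v` are shifted, which is why only letters are compared.
        obtain ⟨u, v, rfl, hu, hB, hv⟩ := ih (A := y :: A) (by simpa using h1)
        refine ⟨u, v ++ [a], by simp, hu, hB, ?_⟩
        rw [freeStack_append_singleton, if_pos ha]
        rcases hs : freeStack i v with _ | ⟨z, st⟩
        · simp [hs] at hv
        · simp only [hs, List.map_cons, List.cons.injEq] at hv
          simp [bracketStep, h3, hv.1, h2, hv.2]
      · rw [h2] at h
        rcases A with _ | ⟨y, A⟩
        · simp only [List.nil_append, List.cons.injEq, Prod.mk.injEq] at h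
          obtain ⟨⟨rfl, rfl⟩, rfl⟩ := h
          exact ⟨w, [], rfl, rfl, rfl, rfl⟩
        · simp only [List.cons_append, List.cons.injEq] at h
          obtain ⟨rfl, h⟩ := h
          obtain ⟨u, v, rfl, hu, hB, hv⟩ := ih h
          refine ⟨u, v ++ [a], by simp, hu, hB, ?_⟩
          rw [freeStack_append_singleton, if_pos ha]
          -- Cancellation depends only on the top letter, and when the part above the chosen letter
          -- is nonempty, `v` and the whole word have the same one.
          rcases bracketStep_cases (i := i) (a := a) (l := v.length) (freeStack i v) with
            ⟨z, st', g1, g2, g3, g4⟩ | ⟨g1, g2⟩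
          · rw [g1] at hv
            rcases A with _ | ⟨y, A⟩
            · simp at hv
            · simp only [List.map_cons, List.cons.injEq] at hv
              exact absurd ⟨hv.1 ▸ g2, g3⟩ (h1 y _ (by rw [h]; rfl))
          · simp [g2, hv]
    · obtain ⟨u, v, rfl, hu, hB, hv⟩ := ih h
      exact ⟨u, v ++ [a], by simp, hu, hB, by rw [freeStack_append_singleton, if_neg ha, hv]⟩

/-- Replacing the free letter that separates the free letters `i` from the free letters `i + 1`. -/
theorem wordState_set {i : ℕ} {w : List ℕ} {A B : List (ℕ × ℕ)} {y : ℕ × ℕ}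
    (h : freeStack i w = A ++ y :: B) (hA : ∀ a ∈ A, a.1 = i + 1) (hB : ∀ b ∈ B, b.1 = i)
    (c : ℕ) :
    wordState i (w.set y.2 c) =
      bicyclicMul (B.length, 0) (bicyclicMul (letterState i c) (0, A.length)) := by
  obtain ⟨u, v, rfl, hu, hu', hv⟩ := freeStack_split (c := y.1) (x := y.2) h
  have hA' : A.map Prod.fst = List.replicate A.length (i + 1) :=
    List.eq_replicate_iff.2 ⟨by simp, by
      intro b hb
      obtain ⟨a, ha, rfl⟩ := List.mem_map.1 hb
      exact hA a ha⟩
  have hB' : B.map Prod.fst = List.replicate B.length i :=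
    List.eq_replicate_iff.2 ⟨by simp, by
      intro b hb
      obtain ⟨a, ha, rfl⟩ := List.mem_map.1 hb
      exact hB a ha⟩
  have h1 : wordState i u = (B.length, 0) := by
    simp [freeStack_count, hu', hB', List.count_replicate]
  have h2 : wordState i v = (0, A.length) := by
    simp [freeStack_count, hv, hA', List.count_replicate]
  rw [← hu, List.set_append_right _ _ le_rfl, Nat.sub_self, List.set_cons_zero, wordState_append,
    wordState_cons, h1, h2]

/-- The letter is replaced by itself in `wordState_set`. -/
theorem wordState_of_freeStack {i : ℕ} {w : List ℕ} {A B : List (ℕ × ℕ)} {y : ℕ × ℕ}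
    (h : freeStack i w = A ++ y :: B) (hA : ∀ a ∈ A, a.1 = i + 1) (hB : ∀ b ∈ B, b.1 = i) :
    wordState i w =
      bicyclicMul (B.length, 0) (bicyclicMul (letterState i y.1) (0, A.length)) := by
  have h1 := wordState_set h hA hB y.1
  obtain ⟨u, v, rfl, hu, -, -⟩ := freeStack_split (c := y.1) (x := y.2) h
  rwa [← hu, List.set_append_right _ _ le_rfl, Nat.sub_self, List.set_cons_zero] at h1

theorem epsilonOp_eq_none {i : ℕ} {w : List ℕ} (h : (wordState i w).2 = 0) :
    epsilonOp i w = none := by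
  rw [freeStack_count] at h
  rw [epsilonOp, Option.map_eq_none_iff, List.find?_eq_none]
  intro x hx hx'
  refine List.count_eq_zero.1 h ?_
  rw [freeLetters, List.mem_reverse] at hx
  have := List.mem_map_of_mem (f := Prod.fst) hx
  rwa [of_decide_eq_true hx'] at this

theorem phiOp_eq_none {i : ℕ} {w : List ℕ} (h : (wordState i w).1 = 0) :
    phiOp i w = none := by
  rw [freeStack_count] at h
  rw [phiOp, Option.map_eq_none_iff, List.find?_eq_none]
  intro x hx hx'
  refine List.count_eq_zero.1 h ?_
  rw [freeLetters, List.reverse_reverse] at hx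
  have := List.mem_map_of_mem (f := Prod.fst) hx
  rwa [of_decide_eq_true hx'] at this

/-- The letter changed is the leftmost free `i + 1`: below it in the stack there are only letters
`i`, above it only `i + 1`. Changing it moves the boundary between the two blocks and creates no new
bracket. -/
theorem epsilonOp_spec {i : ℕ} {w : List ℕ} (h : (wordState i w).2 ≠ 0) :
    ∃ w', epsilonOp i w = some w' ∧ (wordState i w').2 + 1 = (wordState i w).2 := by
  rcases hf : (freeLetters i w).find? fun x => x.1 = i + 1 with _ | y
  · refine absurd ?_ h
    rw [List.find?_eq_none] at hf
    rw [freeStack_count]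
    refine List.count_eq_zero.2 fun hm => ?_
    obtain ⟨x, hx, hx'⟩ := List.mem_map.1 hm
    exact hf x (List.mem_reverse.2 hx) (decide_eq_true hx')
  · refine ⟨w.set y.2 i, by rw [epsilonOp, hf]; rfl, ?_⟩
    rw [List.find?_eq_some_iff_append] at hf
    obtain ⟨hy, as, bs, hl, has⟩ := hf
    have hy : y.1 = i + 1 := of_decide_eq_true hy
    have hst : freeStack i w = bs.reverse ++ y :: as.reverse := by
      rw [← List.reverse_inj]
      simpa [freeLetters, freeStack] using hl
    have hB : ∀ b ∈ as.reverse, b.1 = i := by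
      intro b hb
      have h1 := has b (List.mem_reverse.1 hb)
      have h2 := freeStack_mem (i := i) (w := w) (x := b) (by rw [hst]; simp_all)
      simp only [Bool.not_eq_true', decide_eq_false_iff_not] at h1
      tauto
    have hA : ∀ a ∈ bs.reverse, a.1 = i + 1 := by
      intro a ha
      have h1 := freeStack_pairwise i w
      rw [hst, List.pairwise_append] at h1
      have h2 := h1.2.2 a ha y (by simp)
      have h3 := freeStack_mem (i := i) (w := w) (x := a) (by rw [hst]; simp_all)
      omega
    rw [wordState_set hst hA hB, wordState_of_freeStack hst hA hB, hy]
    simp [letterState, bicyclicMul, add_comm]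

theorem phiOp_spec {i : ℕ} {w : List ℕ} (h : (wordState i w).1 ≠ 0) :
    ∃ w', phiOp i w = some w' ∧ (wordState i w').1 + 1 = (wordState i w).1 := by
  rcases hf : (freeLetters i w).reverse.find? fun x => x.1 = i with _ | y
  · refine absurd ?_ h
    rw [List.find?_eq_none] at hf
    rw [freeStack_count]
    refine List.count_eq_zero.2 fun hm => ?_
    obtain ⟨x, hx, hx'⟩ := List.mem_map.1 hm
    exact hf x (by rw [freeLetters, List.reverse_reverse]; exact hx) (decide_eq_true hx')
  · refine ⟨w.set y.2 (i + 1), by rw [phiOp, hf]; rfl, ?_⟩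
    rw [List.find?_eq_some_iff_append] at hf
    obtain ⟨hy, as, bs, hl, has⟩ := hf
    have hy : y.1 = i := of_decide_eq_true hy
    have hst : freeStack i w = as ++ y :: bs := by
      simpa [freeLetters, freeStack] using hl
    have hA : ∀ a ∈ as, a.1 = i + 1 := by
      intro b hb
      have h1 := has b hb
      have h2 := freeStack_mem (i := i) (w := w) (x := b) (by rw [hst]; simp_all)
      simp only [Bool.not_eq_true', decide_eq_false_iff_not] at h1
      tauto
    have hB : ∀ b ∈ bs, b.1 = i := by
      intro b hb
      have h1 := freeStack_pairwise i w
      rw [hst, List.pairwise_append, List.pairwise_cons] at h1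
      have h2 := h1.2.1.1 b hb
      have h3 := freeStack_mem (i := i) (w := w) (x := b) (by rw [hst]; simp_all)
      omega
    rw [wordState_set hst hA hB, wordState_of_freeStack hst hA hB, hy]
    simp [letterState, bicyclicMul]

theorem iterOp_none (f : List ℕ → Option (List ℕ)) (m : ℕ) :
    (fun o : Option (List ℕ) => o.bind f)^[m] none = none := by
  induction m with
  | zero => rfl
  | succ m ih => rw [Function.iterate_succ_apply]; exact ih

/-- An operator that lowers `g` by one, and vanishes only where `g` does, can be applied exactly
`g w` times to `w`. -/
theorem maxPower_eq {f : List ℕ → Option (List ℕ)} {g : List ℕ → ℕ}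
    (h0 : ∀ w, g w = 0 → f w = none)
    (h1 : ∀ w, g w ≠ 0 → ∃ w', f w = some w' ∧ g w' + 1 = g w) (w : List ℕ) :
    maxPower f w = g w := by
  have key : ∀ m w, iterOp f m w ≠ none ↔ m ≤ g w := by
    intro m
    induction m with
    | zero => simp [iterOp]
    | succ m ih =>
      intro w
      rw [iterOp, Function.iterate_succ_apply, Option.bind_some]
      by_cases hg : g w = 0
      · rw [h0 w hg, iterOp_none]
        simp [hg]
      · obtain ⟨w', hw, hg'⟩ := h1 w hg
        have := ih w'
        rw [iterOp] at this
        rw [hw, this]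
        omega
  have : {m : ℕ | iterOp f m w ≠ none} = Set.Iic (g w) := by
    ext m
    exact key m w
  rw [maxPower, this, csSup_Iic]

theorem exponent_eq_min {lam : YoungDiagram} (T : SemistandardYoungTableau lam) (i : ℕ) :
    exponent T i = min (wordState i (columnWord T)).2 (wordState i (columnWord T)).1 := by
  rw [exponent, maxPower_eq (g := fun w => (wordState i w).2) (fun _ => epsilonOp_eq_none)
    (fun _ => epsilonOp_spec), maxPower_eq (g := fun w => (wordState i w).1)
    (fun _ => phiOp_eq_none) (fun _ => phiOp_spec)]

/-! ### Tableaux as sequences of columns -/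

/-- The sets `C 0`, `C 1`, ... are the columns of a tableau of shape `lam` over the alphabet
`{0, ..., N - 1}`. -/
structure IsColumns (lam : YoungDiagram) (N : ℕ) (C : ℕ → Finset ℕ) : Prop where
  subset : ∀ j, C j ⊆ Finset.range N
  card : ∀ j, (C j).card = lam.colLen j
  count_le : ∀ j, ∀ x ≤ N, Nat.count (· ∈ C (j + 1)) x ≤ Nat.count (· ∈ C j) x

theorem card_toFinset_ofPred_mem {s : Finset ℕ} (hf : (Set.ofPred (· ∈ s)).Finite) :
    hf.toFinset.card = s.card := by
  congr 1
  ext x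
  simp

theorem nth_mem_finset {s : Finset ℕ} {i : ℕ} (h : i < s.card) : Nat.nth (· ∈ s) i ∈ s :=
  Nat.nth_mem (p := (· ∈ s)) i fun hf => by rwa [card_toFinset_ofPred_mem hf]

theorem nth_finset_of_card_le {s : Finset ℕ} {i : ℕ} (h : s.card ≤ i) :
    Nat.nth (· ∈ s) i = 0 :=
  Nat.nth_of_card_le s.finite_toSet (by rwa [card_toFinset_ofPred_mem])

theorem nth_finset_lt {s : Finset ℕ} {i i' : ℕ} (h : i < i') (h' : i' < s.card) :
    Nat.nth (· ∈ s) i < Nat.nth (· ∈ s) i' :=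
  Nat.nth_lt_nth' (p := (· ∈ s)) h fun hf => by rwa [card_toFinset_ofPred_mem hf]

theorem image_nth_finset (s : Finset ℕ) :
    (Finset.range s.card).image (Nat.nth (· ∈ s)) = s := by
  refine Finset.eq_of_subset_of_card_le ?_ ?_
  · intro x hx
    obtain ⟨i, hi, rfl⟩ := Finset.mem_image.1 hx
    exact nth_mem_finset (Finset.mem_range.1 hi)
  · rw [Finset.card_image_of_injOn, Finset.card_range]
    intro i hi i' hi' h
    simp only [Finset.coe_range, Set.mem_Iio] at hi hi'
    rcases lt_trichotomy i i' with hl | hl | hl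
    · exact absurd h (nth_finset_lt hl hi').ne
    · exact hl
    · exact absurd h (nth_finset_lt hl hi).ne'

/-- Passes from the counting form of the row condition to the entrywise one: just past the `i`-th
entry of column `j + 1`, column `j` also has at least `i + 1` letters. -/
theorem IsColumns.nth_le {lam : YoungDiagram} {N : ℕ} {C : ℕ → Finset ℕ} (h : IsColumns lam N C)
    {i j : ℕ} (hi : i < (C (j + 1)).card) :
    Nat.nth (· ∈ C j) i ≤ Nat.nth (· ∈ C (j + 1)) i := by
  have h1 := nth_mem_finset hi
  have h2 := Finset.mem_range.1 (h.subset _ h1)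
  have h3 := h.count_le j _ (Nat.succ_le_of_lt h2)
  rw [Nat.succ_eq_add_one, Nat.count_nth_succ (p := (· ∈ C (j + 1)))
    (fun hf => by rwa [card_toFinset_ofPred_mem hf])] at h3
  exact Nat.lt_succ_iff.1 (Nat.nth_lt_of_lt_count h3)

/-- The tableau with given columns. -/
noncomputable def ofColumns {lam : YoungDiagram} {N : ℕ} {C : ℕ → Finset ℕ}
    (h : IsColumns lam N C) : SemistandardYoungTableau lam where
  entry i j := Nat.nth (· ∈ C j) i
  row_weak' := by
    intro i j1 j2 hj hm
    induction j2, hj using Nat.le_induction with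
    | base => exact h.nth_le (by rwa [h.card, ← YoungDiagram.mem_iff_lt_colLen])
    | succ j2 hj ih =>
      exact (ih (lam.up_left_mem le_rfl (Nat.le_succ _) hm)).trans
        (h.nth_le (by rwa [h.card, ← YoungDiagram.mem_iff_lt_colLen]))
  col_strict' := by
    intro i1 i2 j hi hm
    exact nth_finset_lt hi (by rwa [h.card, ← YoungDiagram.mem_iff_lt_colLen])
  zeros' := by
    intro i j hm
    -- `Nat.nth` is `0` past the end of a finite set, as a tableau is outside its shape.
    exact nth_finset_of_card_le (by rwa [h.card, ← not_lt, ← YoungDiagram.mem_iff_lt_colLen])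

@[simp] theorem columnSet_ofColumns {lam : YoungDiagram} {N : ℕ} {C : ℕ → Finset ℕ}
    (h : IsColumns lam N C) (j : ℕ) : columnSet (ofColumns h) j = C j := by
  rw [columnSet, ← h.card]
  exact image_nth_finset (C j)

section

variable {lam : YoungDiagram} (T : SemistandardYoungTableau lam)

theorem tableau_lt {i i' j : ℕ} (h : i < i') (h' : i' < lam.colLen j) : T i j < T i' j :=
  T.col_strict h (YoungDiagram.mem_iff_lt_colLen.2 h')

theorem tableau_injOn (j : ℕ) : Set.InjOn (fun i => T i j) (Finset.range (lam.colLen j)) := by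
  intro i hi i' hi' h
  simp only [Finset.coe_range, Set.mem_Iio] at hi hi'
  rcases lt_trichotomy i i' with hl | hl | hl
  · exact absurd h (tableau_lt T hl hi').ne
  · exact hl
  · exact absurd h (tableau_lt T hl hi).ne'

theorem tableau_mem_columnSet {i j : ℕ} (h : i < lam.colLen j) : T i j ∈ columnSet T j :=
  Finset.mem_image_of_mem _ (Finset.mem_range.2 h)

theorem card_columnSet (j : ℕ) : (columnSet T j).card = lam.colLen j := by
  rw [columnSet, Finset.card_image_of_injOn (tableau_injOn T j), Finset.card_range]

theorem count_columnSet (j x : ℕ) : Nat.count (· ∈ columnSet T j) x =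
    ((Finset.range (lam.colLen j)).filter fun i => T i j < x).card := by
  rw [Nat.count_eq_card_filter_range, ← Finset.card_image_of_injOn
    (s := (Finset.range (lam.colLen j)).filter fun i => T i j < x)
    ((tableau_injOn T j).mono (Finset.coe_subset.2 (Finset.filter_subset _ _)))]
  congr 1
  ext y
  simp only [columnSet, Finset.mem_filter, Finset.mem_range, Finset.mem_image]
  constructor
  · rintro ⟨h, i, hi, rfl⟩
    exact ⟨i, ⟨hi, h⟩, rfl⟩
  · rintro ⟨i, ⟨hi, h⟩, rfl⟩
    exact ⟨h, i, hi, rfl⟩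

theorem nth_columnSet {i j : ℕ} (h : i < lam.colLen j) :
    Nat.nth (· ∈ columnSet T j) i = T i j := by
  -- By strictness, the entries of the column smaller than `T i j` are exactly the `i` entries above
  -- it.
  have h1 : Nat.count (· ∈ columnSet T j) (T i j) = i := by
    rw [count_columnSet]
    convert Finset.card_range i using 2
    ext i'
    simp only [Finset.mem_filter, Finset.mem_range]
    constructor
    · rintro ⟨h1, h2⟩
      by_contra hle
      rcases (not_lt.1 hle).eq_or_lt with rfl | hl
      · exact lt_irrefl _ h2
      · exact lt_asymm h2 (tableau_lt T hl h1)
    · intro hi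
      exact ⟨hi.trans h, tableau_lt T hi h⟩
  conv_lhs => rw [← h1]
  exact Nat.nth_count (p := (· ∈ columnSet T j)) (tableau_mem_columnSet T h)

theorem eq_of_columnSet {T T' : SemistandardYoungTableau lam}
    (h : ∀ j, columnSet T j = columnSet T' j) : T = T' := by
  ext i j
  by_cases hc : i < lam.colLen j
  · rw [← nth_columnSet T hc, ← nth_columnSet T' hc, h]
  · rw [← YoungDiagram.mem_iff_lt_colLen] at hc
    rw [T.zeros hc, T'.zeros hc]

theorem count_columnSet_succ_le (j x : ℕ) : Nat.count (· ∈ columnSet T (j + 1)) x ≤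
    Nat.count (· ∈ columnSet T j) x := by
  rw [count_columnSet, count_columnSet]
  refine Finset.card_le_card fun i hi => ?_
  simp only [Finset.mem_filter, Finset.mem_range] at hi ⊢
  exact ⟨hi.1.trans_le (lam.colLen_anti _ _ (Nat.le_succ j)),
    (T.row_weak (Nat.lt_succ_self j) (YoungDiagram.mem_iff_lt_colLen.2 hi.1)).trans_lt hi.2⟩

variable {T} in
theorem columnSet_subset {N : ℕ} (h : ∀ c ∈ lam.cells, T c.1 c.2 < N) (j : ℕ) :
    columnSet T j ⊆ Finset.range N := by
  intro x hx
  obtain ⟨i, hi, rfl⟩ := Finset.mem_image.1 hx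
  exact Finset.mem_range.2
    (h (i, j) (YoungDiagram.mem_iff_lt_colLen.2 (Finset.mem_range.1 hi)))

variable {T} in
theorem lt_of_columnSet_subset {N : ℕ} (h : ∀ j, columnSet T j ⊆ Finset.range N) :
    ∀ c ∈ lam.cells, T c.1 c.2 < N := fun c hc =>
  Finset.mem_range.1 (h c.2 (tableau_mem_columnSet T (YoungDiagram.mem_iff_lt_colLen.1 hc)))

theorem colLen_eq_zero {j : ℕ} (h : lam.rowLen 0 ≤ j) : lam.colLen j = 0 := by
  by_contra hne
  have h1 : (0, j) ∈ lam := YoungDiagram.mem_iff_lt_colLen.2 (Nat.pos_of_ne_zero hne)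
  have h2 := YoungDiagram.mem_iff_lt_rowLen.1 h1
  omega

theorem columnSet_eq_empty {j : ℕ} (h : lam.rowLen 0 ≤ j) : columnSet T j = ∅ := by
  simp [columnSet, colLen_eq_zero h]

/-- A column contains each letter at most once. The slack in `R` allows empty columns, so that
shapes of different widths can be compared. -/
theorem mult_eq_card_columns {R : ℕ} (hR : lam.rowLen 0 ≤ R) (a : ℕ) :
    mult T a = ((Finset.range R).filter fun j => a ∈ columnSet T j).card := by
  rw [mult]
  refine Finset.card_bij (fun c _ => c.2) ?_ ?_ ?_
  · intro c hc
    simp only [Finset.mem_filter, YoungDiagram.mem_cells, Finset.mem_range] at hc ⊢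
    have hc1 := YoungDiagram.mem_iff_lt_colLen.1 hc.1
    refine ⟨?_, hc.2 ▸ tableau_mem_columnSet T hc1⟩
    by_contra hle
    rw [colLen_eq_zero (hR.trans (not_lt.1 hle))] at hc1
    omega
  · rintro ⟨i, j⟩ hc ⟨i', j'⟩ hc' h
    simp only [Finset.mem_filter, YoungDiagram.mem_cells, YoungDiagram.mem_iff_lt_colLen]
      at hc hc' h
    subst h
    rw [tableau_injOn T j (by simpa using hc.1) (by simpa using hc'.1) (hc.2.trans hc'.2.symm)]
  · intro j hj
    obtain ⟨i, hi, hij⟩ := Finset.mem_image.1 (Finset.mem_filter.1 hj).2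
    exact ⟨(i, j), by simpa [YoungDiagram.mem_iff_lt_colLen, hij] using hi, rfl⟩

end

/-! ### The exponents in terms of columns -/

/-- The class of a column in the bicyclic monoid. -/
def columnState (i : ℕ) (s : Finset ℕ) : ℕ × ℕ :=
  (if i ∈ s ∧ i + 1 ∉ s then 1 else 0, if i + 1 ∈ s ∧ i ∉ s then 1 else 0)

/-- If `i` and `i + 1` both occur in a decreasing word, they occur as the factor `(i + 1) i` and
cancel. -/
theorem wordState_of_pairwise_gt (i : ℕ) {w : List ℕ} (hw : w.Pairwise (· > ·)) :
    wordState i w = columnState i w.toFinset := by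
  induction w with
  | nil => rfl
  | cons a w ih =>
    rw [List.pairwise_cons] at hw
    rw [wordState_cons, ih hw.2]
    have h1 : i + 1 ∈ w → i + 1 < a := hw.1 _
    have h2 : i ∈ w → i < a := hw.1 _
    by_cases ha : a = i
    · subst ha
      simp [columnState, letterState, bicyclicMul, show a + 1 ∉ w by intro h; have := h1 h; omega,
        show a ∉ w by intro h; have := h2 h; omega]
    · by_cases ha' : a = i + 1
      · subst ha'
        simp only [lt_self_iff_false, imp_false] at h1
        by_cases hi : i ∈ w <;> simp [columnState, letterState, bicyclicMul, h1, hi]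
      · simp [columnState, letterState, Ne.symm ha, Ne.symm ha', ha, ha']

theorem wordState_columnWord {lam : YoungDiagram} (T : SemistandardYoungTableau lam) {R : ℕ}
    (hR : lam.rowLen 0 ≤ R) (i : ℕ) :
    wordState i (columnWord T) =
      bicyclicProd ((List.range R).map fun j => columnState i (columnSet T j)) := by
  rw [columnWord, wordState_flatMap]
  have h1 : ∀ j, wordState i ((List.range (lam.colLen j)).map fun i => T i j).reverse =
      columnState i (columnSet T j) := by
    intro j
    rw [wordState_of_pairwise_gt]
    · congr 1
      ext x
      simp [columnSet]
    · rw [List.pairwise_reverse, List.pairwise_map]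
      refine List.Pairwise.imp_of_mem ?_ List.pairwise_lt_range
      intro a b _ hb hab
      exact tableau_lt T hab (List.mem_range.1 hb)
  simp only [h1]
  obtain ⟨d, rfl⟩ := Nat.exists_eq_add_of_le hR
  rw [List.range_add, List.map_append, bicyclicProd_append, bicyclicProd_eq_zero
    (l := List.map _ (List.map _ _)), bicyclicMul_zero]
  intro x hx
  simp only [List.map_map, List.mem_map, Function.comp_apply] at hx
  obtain ⟨j, -, rfl⟩ := hx
  rw [columnSet_eq_empty T (Nat.le_add_right _ _)]
  simp [columnState]

theorem exponent_eq_columns {lam : YoungDiagram} (T : SemistandardYoungTableau lam) {R : ℕ}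
    (hR : lam.rowLen 0 ≤ R) (i : ℕ) :
    exponent T i =
      min (bicyclicProd ((List.range R).map fun j => columnState i (columnSet T j))).2
        (bicyclicProd ((List.range R).map fun j => columnState i (columnSet T j))).1 := by
  rw [exponent_eq_min, wordState_columnWord T hR]

/-- Each cancellation removes one `i` and one `i + 1`, so the difference of their numbers is
invariant; it is stated additively to avoid subtraction in `ℕ`. -/
theorem bicyclicProd_columns_balance (i R : ℕ) (C : ℕ → Finset ℕ) :
    (bicyclicProd ((List.range R).map fun j => columnState i (C j))).1 +
        ((Finset.range R).filter fun j => i + 1 ∈ C j).card =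
      (bicyclicProd ((List.range R).map fun j => columnState i (C j))).2 +
        ((Finset.range R).filter fun j => i ∈ C j).card := by
  induction R with
  | zero => rfl
  | succ R ih =>
    rw [List.range_succ, List.map_append, bicyclicProd_append, Finset.range_add_one,
      Finset.filter_insert, Finset.filter_insert]
    generalize bicyclicProd ((List.range R).map fun j => columnState i (C j)) = s at ih ⊢
    by_cases h : i ∈ C R <;> by_cases h' : i + 1 ∈ C R <;>
      simp [h, h', bicyclicProd, columnState, bicyclicMul] <;> omega

theorem bicyclicProd_columns_fst_le (i R : ℕ) (C : ℕ → Finset ℕ) :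
    (bicyclicProd ((List.range R).map fun j => columnState i (C j))).1 ≤
      ((Finset.range R).filter fun j => i ∈ C j).card := by
  induction R with
  | zero => rfl
  | succ R ih =>
    rw [List.range_succ, List.map_append, bicyclicProd_append, Finset.range_add_one,
      Finset.filter_insert]
    generalize bicyclicProd ((List.range R).map fun j => columnState i (C j)) = s at ih ⊢
    by_cases h : i ∈ C R <;> by_cases h' : i + 1 ∈ C R <;>
      simp [h, h', bicyclicProd, columnState, bicyclicMul] <;> omega

theorem columnState_sdiff {i N : ℕ} (h : i + 1 < N) (s : Finset ℕ) :
    columnState i (Finset.range N \ s) = (columnState i s).swap := by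
  have h' : i < N := by omega
  by_cases h1 : i ∈ s <;> by_cases h2 : i + 1 ∈ s <;> simp [columnState, h, h', h1, h2]

theorem map_range_reflect {X : Type*} (R : ℕ) (f : ℕ → X) :
    (List.range R).map (fun j => f (R - 1 - j)) = ((List.range R).map f).reverse := by
  refine List.ext_getElem (by simp) fun j h1 h2 => ?_
  simp

/-- Complementing and reversing a sequence of columns exchanges the numbers of free letters. -/
theorem bicyclicProd_complement {i N : ℕ} (h : i + 1 < N) (R : ℕ) {C D : ℕ → Finset ℕ}
    (hD : ∀ j < R, D j = Finset.range N \ C (R - 1 - j)) :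
    bicyclicProd ((List.range R).map fun j => columnState i (D j)) =
      (bicyclicProd ((List.range R).map fun j => columnState i (C j))).swap := by
  rw [← bicyclicProd_map_swap_reverse, List.map_map, ← map_range_reflect]
  congr 1
  refine List.map_congr_left fun j hj => ?_
  rw [hD j (List.mem_range.1 hj), columnState_sdiff h]
  rfl

/-! ### The columns of the shapes -/

theorem colLen_pairShape_of_lt {n k : ℕ} {α β : YoungDiagram} (hβ : β.rowLen 0 ≤ k)
    (hlen : α.colLen 0 + β.colLen 0 ≤ n + 1) {j : ℕ} (hj : j < k) :
    (pairShape n k α β).colLen j = n + 1 - β.colLen (k - 1 - j) := by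
  refine eq_of_forall_lt_iff fun i => ?_
  rw [← YoungDiagram.mem_iff_lt_colLen, mem_pairShape]
  by_cases hi : i ≤ n
  · have h1 : k - 1 - j < β.rowLen (n - i) ↔ n - i < β.colLen (k - 1 - j) := by
      rw [← YoungDiagram.mem_iff_lt_rowLen, YoungDiagram.mem_iff_lt_colLen]
    have h2 := β.rowLen_anti 0 (n - i) (Nat.zero_le _)
    -- By the bound on the lengths, no row is both lengthened by `α` and shortened by `β`.
    rcases le_or_gt (β.colLen 0) (n - i) with h | h
    · have := rowLen_eq_zero h
      omega
    · have := rowLen_eq_zero (α := α) (i := i) (by omega)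
      omega
  · omega

theorem colLen_pairShape_add {n k : ℕ} {α β : YoungDiagram} (hβ : β.rowLen 0 ≤ k)
    (hlen : α.colLen 0 + β.colLen 0 ≤ n + 1) (t : ℕ) :
    (pairShape n k α β).colLen (k + t) = α.colLen t := by
  refine eq_of_forall_lt_iff fun i => ?_
  have h1 : t < α.rowLen i ↔ i < α.colLen t := by
    rw [← YoungDiagram.mem_iff_lt_rowLen, YoungDiagram.mem_iff_lt_colLen]
  have h2 := α.colLen_anti 0 t (Nat.zero_le _)
  have h3 := β.rowLen_anti 0 (n - i) (Nat.zero_le _)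
  rw [← YoungDiagram.mem_iff_lt_colLen, mem_pairShape]
  by_cases hi : i ≤ n
  · rcases le_or_gt (β.colLen 0) (n - i) with h | h
    · have := rowLen_eq_zero h
      omega
    · have := rowLen_eq_zero (α := α) (i := i) (by omega)
      omega
  · omega

theorem rowLen_zero_pairShape_le (n k : ℕ) (α β : YoungDiagram) :
    (pairShape n k α β).rowLen 0 ≤ k + α.rowLen 0 := by
  rw [rowLen_pairShape (Nat.zero_le _)]
  exact Nat.sub_le _ _

/-! ### Complements of columns -/

theorem count_sdiff {N x : ℕ} (hx : x ≤ N) (s : Finset ℕ) :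
    Nat.count (· ∈ Finset.range N \ s) x + Nat.count (· ∈ s) x = x := by
  induction x with
  | zero => simp
  | succ x ih =>
    have := ih (by omega)
    have h' : x < N := by omega
    rw [Nat.count_succ, Nat.count_succ]
    by_cases h : x ∈ s
    · rw [if_pos h, if_neg (by simp [h])]
      omega
    · rw [if_neg h, if_pos (by simp [h, h'])]
      omega

theorem card_columns_complement {N R a : ℕ} (ha : a < N) {C D : ℕ → Finset ℕ}
    (hD : ∀ j < R, D j = Finset.range N \ C (R - 1 - j)) :
    ((Finset.range R).filter fun j => a ∈ D j).card +
      ((Finset.range R).filter fun j => a ∈ C j).card = R := by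
  have h1 : ((Finset.range R).filter fun j => a ∈ D j).card =
      ((Finset.range R).filter fun j => ¬ a ∈ C j).card := by
    rw [Finset.card_filter, Finset.card_filter, ← Finset.sum_range_reflect]
    refine Finset.sum_congr rfl fun j hj => ?_
    have hj := Finset.mem_range.1 hj
    rw [hD _ (by omega), show R - 1 - (R - 1 - j) = j by omega]
    simp [ha]
  rw [h1, add_comm, Finset.card_filter_add_card_filter_not, Finset.card_range]

/-- The sequence of the complements of the first `R` columns, in the opposite order. -/
def complementColumns (N R : ℕ) (C : ℕ → Finset ℕ) (j : ℕ) : Finset ℕ :=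
  if j < R then Finset.range N \ C (R - 1 - j) else ∅

theorem complementColumns_of_lt {N R : ℕ} (C : ℕ → Finset ℕ) {j : ℕ} (hj : j < R) :
    complementColumns N R C j = Finset.range N \ C (R - 1 - j) := if_pos hj

theorem complementColumns_of_le {N R : ℕ} (C : ℕ → Finset ℕ) {j : ℕ} (hj : R ≤ j) :
    complementColumns N R C j = ∅ := if_neg (not_lt.2 hj)

/-- Below `x`, a set and its complement together have `x` letters. Complementing thus reverses the
inequality between adjacent columns, and reversing their order restores it. -/
theorem isColumns_complementColumns {lam lam' : YoungDiagram} {N R : ℕ} {C : ℕ → Finset ℕ}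
    (hC : IsColumns lam N C) (h : ∀ j < R, lam'.colLen j = N - lam.colLen (R - 1 - j))
    (h' : ∀ j, R ≤ j → lam'.colLen j = 0) : IsColumns lam' N (complementColumns N R C) where
  subset j := by
    rw [complementColumns]
    split_ifs <;> simp
  card j := by
    rcases lt_or_ge j R with hj | hj
    · rw [complementColumns_of_lt C hj, Finset.card_sdiff_of_subset (hC.subset _), Finset.card_range,
        hC.card, h j hj]
    · rw [complementColumns_of_le C hj, h' j hj, Finset.card_empty]
  count_le j x hx := by
    rcases lt_or_ge (j + 1) R with hj | hj
    · have h1 := hC.count_le (R - 1 - (j + 1)) x hx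
      have h2 := count_sdiff hx (C (R - 1 - (j + 1)))
      have h3 := count_sdiff hx (C (R - 1 - j))
      rw [show R - 1 - (j + 1) + 1 = R - 1 - j by omega] at h1
      rw [complementColumns_of_lt C hj, complementColumns_of_lt C (by omega)]
      omega
    · rw [complementColumns_of_le C hj]
      simp

theorem isColumns_columnSet {lam : YoungDiagram} {N : ℕ} {T : SemistandardYoungTableau lam}
    (h : ∀ c ∈ lam.cells, T c.1 c.2 < N) : IsColumns lam N (columnSet T) :=
  ⟨columnSet_subset h, card_columnSet T, fun j x _ => count_columnSet_succ_le T j x⟩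

/-! ### The complement bijection between the two shapes. -/

theorem colLen_pairShape_swap {n k : ℕ} {α β : YoungDiagram} (hα : α.rowLen 0 ≤ k)
    (hβ : β.rowLen 0 ≤ k) (hlen : α.colLen 0 + β.colLen 0 ≤ n + 1) (j : ℕ) (hj : j < 2 * k) :
    (pairShape n k β α).colLen j =
      n + 1 - (pairShape n k α β).colLen (2 * k - 1 - j) := by
  rcases lt_or_ge j k with h | h
  · rw [colLen_pairShape_of_lt hα (by omega) h, show 2 * k - 1 - j = k + (k - 1 - j) by omega,
      colLen_pairShape_add hβ hlen]
  · obtain ⟨t, rfl⟩ := Nat.exists_eq_add_of_le h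
    rw [colLen_pairShape_add hα (by omega), colLen_pairShape_of_lt hβ hlen (by omega),
      show k - 1 - (2 * k - 1 - (k + t)) = t by omega]
    have := β.colLen_anti 0 t (Nat.zero_le _)
    omega

theorem colLen_pairShape_of_two_mul_le {n k : ℕ} {α β : YoungDiagram} (hα : α.rowLen 0 ≤ k)
    (j : ℕ) (hj : 2 * k ≤ j) : (pairShape n k α β).colLen j = 0 :=
  colLen_eq_zero ((rowLen_zero_pairShape_le n k α β).trans (by omega))

theorem isColumns_complement_pairShape {n k : ℕ} {α β : YoungDiagram} (hα : α.rowLen 0 ≤ k)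
    (hβ : β.rowLen 0 ≤ k) (hlen : α.colLen 0 + β.colLen 0 ≤ n + 1)
    (T : RectTab n k (pairShape n k α β)) :
    IsColumns (pairShape n k β α) (n + 1) (complementColumns (n + 1) (2 * k) (columnSet T.1)) :=
  isColumns_complementColumns (isColumns_columnSet T.2.1) (colLen_pairShape_swap hα hβ hlen)
    (colLen_pairShape_of_two_mul_le hβ)

/-- The tableau obtained by complementing the first `2 * k` columns. -/
noncomputable def complementTab {n k : ℕ} {α β : YoungDiagram} (hα : α.rowLen 0 ≤ k)
    (hβ : β.rowLen 0 ≤ k) (hlen : α.colLen 0 + β.colLen 0 ≤ n + 1)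
    (T : RectTab n k (pairShape n k α β)) : RectTab n k (pairShape n k β α) :=
  ⟨ofColumns (isColumns_complement_pairShape hα hβ hlen T), by
    refine ⟨lt_of_columnSet_subset fun j => ?_, fun a => ?_⟩
    · rw [columnSet_ofColumns]
      exact (isColumns_complement_pairShape hα hβ hlen T).subset j
    · have h1 := rowLen_zero_pairShape_le n k α β
      have h2 := rowLen_zero_pairShape_le n k β α
      have h3 : mult T.1 a = k := T.2.2 a
      rw [mult_eq_card_columns _ (R := 2 * k) (by omega)] at h3 ⊢
      simp only [columnSet_ofColumns]
      -- Each letter misses `2 * k - k = k` of the first `2 * k` columns, so the weight stays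
      -- rectangular.
      have h4 := card_columns_complement (R := 2 * k) a.2
        fun j hj => complementColumns_of_lt (columnSet T.1) hj
      omega⟩

theorem isColumnComplement_complementTab {n k : ℕ} {α β : YoungDiagram} (hα : α.rowLen 0 ≤ k)
    (hβ : β.rowLen 0 ≤ k) (hlen : α.colLen 0 + β.colLen 0 ≤ n + 1)
    (T : RectTab n k (pairShape n k α β)) :
    IsColumnComplement n k T.1 (complementTab hα hβ hlen T).1 := by
  intro j hj
  rw [complementTab, columnSet_ofColumns, complementColumns_of_lt _ hj]

theorem complementTab_complementTab {n k : ℕ} {α β : YoungDiagram} (hα : α.rowLen 0 ≤ k)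
    (hβ : β.rowLen 0 ≤ k) (hlen : α.colLen 0 + β.colLen 0 ≤ n + 1)
    (hlen' : β.colLen 0 + α.colLen 0 ≤ n + 1) (T : RectTab n k (pairShape n k α β)) :
    complementTab hβ hα hlen' (complementTab hα hβ hlen T) = T := by
  refine Subtype.ext (eq_of_columnSet fun j => ?_)
  rcases lt_or_ge j (2 * k) with hj | hj
  · rw [isColumnComplement_complementTab hβ hα hlen' _ j hj,
      isColumnComplement_complementTab hα hβ hlen _ _ (by omega),
      Finset.sdiff_sdiff_eq_self (columnSet_subset T.2.1 _),
      show 2 * k - 1 - (2 * k - 1 - j) = j by omega]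
  · have h1 := rowLen_zero_pairShape_le n k α β
    rw [columnSet_eq_empty _ (by omega), columnSet_eq_empty _ (by omega)]

/-- In rectangular weight the word of a tableau has as many free letters `i` as `i + 1`. -/
theorem exponent_rectTab {n k : ℕ} {lam : YoungDiagram} (T : RectTab n k lam) {R : ℕ}
    (hR : lam.rowLen 0 ≤ R) (i : Fin n) :
    exponent T.1 i =
        (bicyclicProd ((List.range R).map fun j => columnState i (columnSet T.1 j))).1 ∧
      exponent T.1 i =
        (bicyclicProd ((List.range R).map fun j => columnState i (columnSet T.1 j))).2 := by
  have h1 := bicyclicProd_columns_balance i R (columnSet T.1)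
  have h2 := T.2.2 i.castSucc
  have h3 := T.2.2 i.succ
  rw [mult_eq_card_columns _ hR] at h2 h3
  simp only [Fin.val_castSucc, Fin.val_succ] at h2 h3
  rw [exponent_eq_columns T.1 hR]
  omega

/-- Complementing exchanges the two numbers of free letters, and in rectangular weight either of
them is the exponent. -/
theorem exponent_complementTab {n k : ℕ} {α β : YoungDiagram} (hα : α.rowLen 0 ≤ k)
    (hβ : β.rowLen 0 ≤ k) (hlen : α.colLen 0 + β.colLen 0 ≤ n + 1)
    (T : RectTab n k (pairShape n k α β)) (i : Fin n) :
    exponent (complementTab hα hβ hlen T).1 i = exponent T.1 i := by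
  have h1 := rowLen_zero_pairShape_le n k α β
  have h2 := rowLen_zero_pairShape_le n k β α
  rw [(exponent_rectTab T (R := 2 * k) (by omega) i).2,
    (exponent_rectTab (complementTab hα hβ hlen T) (R := 2 * k) (by omega) i).1,
    bicyclicProd_complement (N := n + 1) (by omega) (2 * k)
      (isColumnComplement_complementTab hα hβ hlen T)]
  rfl

/-- Complementing columns as a bijection. -/
noncomputable def complementEquiv {n k : ℕ} {α β : YoungDiagram} (hα : α.rowLen 0 ≤ k)
    (hβ : β.rowLen 0 ≤ k) (hlen : α.colLen 0 + β.colLen 0 ≤ n + 1) :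
    RectTab n k (pairShape n k α β) ≃ RectTab n k (pairShape n k β α) where
  toFun := complementTab hα hβ hlen
  invFun := complementTab hβ hα ((add_comm _ _).trans_le hlen)
  left_inv := complementTab_complementTab hα hβ hlen _
  right_inv := complementTab_complementTab hβ hα _ hlen

theorem genExpPoly_pairShape_swap {n k : ℕ} {α β : YoungDiagram} (hα : α.rowLen 0 ≤ k)
    (hβ : β.rowLen 0 ≤ k) (hlen : α.colLen 0 + β.colLen 0 ≤ n + 1) :
    genExpPoly n k (pairShape n k α β) = genExpPoly n k (pairShape n k β α) :=
  Fintype.sum_equiv (complementEquiv hα hβ hlen) _ _ fun T =>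
    Finset.prod_congr rfl fun i _ =>
      congrArg _ (exponent_complementTab hα hβ hlen T i).symm

/-! ### One-row shapes -/

theorem mem_rowPartition {m i j : ℕ} : (i, j) ∈ rowPartition m ↔ i = 0 ∧ j < m := by
  rw [← YoungDiagram.mem_cells]
  simp [rowPartition, eq_comm, and_comm]

theorem card_rowPartition (m : ℕ) : (rowPartition m).card = m := by
  simp [YoungDiagram.card, rowPartition]

theorem rowLen_rowPartition (m : ℕ) : (rowPartition m).rowLen 0 = m := by
  refine eq_of_forall_lt_iff fun j => ?_
  rw [← YoungDiagram.mem_iff_lt_rowLen, mem_rowPartition]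
  simp

theorem colLen_rowPartition_of_lt {m t : ℕ} (h : t < m) : (rowPartition m).colLen t = 1 := by
  refine eq_of_forall_lt_iff fun i => ?_
  rw [← YoungDiagram.mem_iff_lt_colLen, mem_rowPartition]
  omega

theorem rowLen_le_card (α : YoungDiagram) (i : ℕ) : α.rowLen i ≤ α.card := by
  rw [YoungDiagram.rowLen_eq_card]
  exact Finset.card_le_card (Finset.filter_subset _ _)

/-! ### Sorted words -/

/-- No `i + 1` precedes an `i`, so nothing cancels. -/
theorem wordState_of_sorted (i : ℕ) {w : List ℕ} (hw : w.Pairwise (· ≤ ·)) :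
    wordState i w = (w.count i, w.count (i + 1)) := by
  induction w with
  | nil => rfl
  | cons a w ih =>
    rw [List.pairwise_cons] at hw
    rw [wordState_cons, ih hw.2, List.count_cons, List.count_cons]
    by_cases ha : a = i
    · simp [ha, letterState, bicyclicMul, add_comm]
    · by_cases ha' : a = i + 1
      · have : w.count i = 0 := List.count_eq_zero.2 fun h => by
          have := hw.1 i h
          omega
        simp [ha', letterState, bicyclicMul, this]
      · simp [ha, ha', letterState]

theorem card_columns_append_row {k : ℕ} {C : ℕ → Finset ℕ} (L : List ℕ)
    (hL : ∀ t (h : t < L.length), C (k + t) = {L[t]}) (a : ℕ) :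
    ((Finset.range (k + L.length)).filter fun j => a ∈ C j).card =
      ((Finset.range k).filter fun j => a ∈ C j).card + L.count a := by
  induction L using List.reverseRecOn with
  | nil => simp
  | append_singleton L b ih =>
    have h1 := ih fun t h => by
      rw [hL t (by rw [List.length_append]; omega), List.getElem_append_left h]
    have h2 : C (k + L.length) = {b} := by
      rw [hL L.length (by simp)]
      simp
    rw [List.length_append, List.length_singleton, ← add_assoc, Finset.range_add_one,
      Finset.filter_insert, h2, List.count_append, ← add_assoc, ← h1]
    by_cases hab : a = b
    · simp [hab]
    · simp [hab, Ne.symm hab]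

theorem bicyclicProd_append_row {k : ℕ} {C : ℕ → Finset ℕ} (L : List ℕ)
    (hL : ∀ t (h : t < L.length), C (k + t) = {L[t]}) (i : ℕ) :
    bicyclicProd ((List.range (k + L.length)).map fun j => columnState i (C j)) =
      bicyclicMul (bicyclicProd ((List.range k).map fun j => columnState i (C j)))
        (wordState i L) := by
  rw [List.range_add, List.map_append, bicyclicProd_append, wordState]
  congr 2
  refine List.ext_getElem (by simp) fun t h1 h2 => ?_
  simp only [List.length_map] at h2
  simp only [List.getElem_map, List.getElem_range, hL t h2, columnState, letterState,
    Finset.mem_singleton]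
  split_ifs <;> first | rfl | omega

/-! ### Peeling off the first columns -/

/-- The columns containing the least letter form an initial segment, and there are `k` of them. -/
theorem zero_mem_columnSet {n k : ℕ} {lam : YoungDiagram} (T : RectTab n k lam) {j : ℕ}
    (hj : j < k) : 0 ∈ columnSet T.1 j := by
  by_contra hn
  have h1 : ∀ j', j ≤ j' → 0 ∉ columnSet T.1 j' := by
    intro j' hj'
    induction j', hj' using Nat.le_induction with
    | base => exact hn
    | succ j' _ ih =>
      intro h
      have := count_columnSet_succ_le T.1 j' 1
      simp [Nat.count_succ, ih, h] at this
  have h2 : mult T.1 0 = k := T.2.2 0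
  rw [mult_eq_card_columns T.1 le_rfl] at h2
  have h3 : ((Finset.range (lam.rowLen 0)).filter fun j' => 0 ∈ columnSet T.1 j') ⊆
      Finset.range j := fun j' hj' => by
    rw [Finset.mem_range]
    by_contra hle
    exact h1 j' (not_lt.1 hle) (Finset.mem_filter.1 hj').2
  have h4 := Finset.card_le_card h3
  rw [h2, Finset.card_range] at h4
  omega

theorem count_eq_card {N : ℕ} {s : Finset ℕ} (hs : s ⊆ Finset.range N) :
    Nat.count (· ∈ s) N = s.card := by
  rw [Nat.count_eq_card_filter_range, Finset.filter_mem_eq_inter,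
    Finset.inter_eq_right.2 hs]

/-- Since `0 ∈ s`, the complement of `s` avoids `0`. Lowering its letters by one is then harmless
and shifts the bound from `x + 1` to `x`. -/
theorem count_filter_succ_notMem {n x : ℕ} (hx : x ≤ n) {s : Finset ℕ} (h0 : 0 ∈ s) :
    Nat.count (· ∈ (Finset.range n).filter fun y => y + 1 ∉ s) x + Nat.count (· ∈ s) (x + 1) =
      x + 1 := by
  induction x with
  | zero => simp [Nat.count_succ, h0]
  | succ x ih =>
    have := ih (by omega)
    have h' : x < n := by omega
    rw [Nat.count_succ, Nat.count_succ (· ∈ s) (x + 1)]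
    by_cases h : x + 1 ∈ s
    · rw [if_pos h, if_neg (by simp [h])]
      omega
    · rw [if_neg h, if_pos (by simp [h, h'])]
      omega

/-- The complements of the first `k` columns in the opposite order, with all letters lowered by
one. -/
def peelColumns (n k : ℕ) (C : ℕ → Finset ℕ) (j : ℕ) : Finset ℕ :=
  if j < k then (Finset.range n).filter fun x => x + 1 ∉ C (k - 1 - j) else ∅

theorem peelColumns_of_lt (n : ℕ) {k : ℕ} (C : ℕ → Finset ℕ) {j : ℕ} (hj : j < k) :
    peelColumns n k C j = (Finset.range n).filter fun x => x + 1 ∉ C (k - 1 - j) := if_pos hj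

theorem peelColumns_of_le (n : ℕ) {k : ℕ} (C : ℕ → Finset ℕ) {j : ℕ} (hj : k ≤ j) :
    peelColumns n k C j = ∅ := if_neg (not_lt.2 hj)

theorem isColumns_peelColumns {n k : ℕ} {α β : YoungDiagram} (hβ : β.rowLen 0 ≤ k)
    (hlen : α.colLen 0 + β.colLen 0 ≤ n + 1) (T : RectTab n k (pairShape n k α β)) :
    IsColumns β n (peelColumns n k (columnSet T.1)) where
  subset j := by
    rw [peelColumns]
    split_ifs <;> simp
  card j := by
    rcases lt_or_ge j k with hj | hj
    · have h1 := count_filter_succ_notMem le_rfl (zero_mem_columnSet T (j := k - 1 - j) (by omega))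
        (n := n)
      rw [count_eq_card (Finset.filter_subset _ _), count_eq_card (columnSet_subset T.2.1 _),
        card_columnSet, colLen_pairShape_of_lt hβ hlen (by omega),
        show k - 1 - (k - 1 - j) = j by omega] at h1
      have h2 := β.colLen_anti 0 j (Nat.zero_le _)
      rw [peelColumns_of_lt _ _ hj]
      omega
    · rw [peelColumns_of_le _ _ hj, colLen_eq_zero (hβ.trans hj), Finset.card_empty]
  count_le j x hx := by
    rcases lt_or_ge (j + 1) k with hj | hj
    · have h1 := count_filter_succ_notMem hx
        (zero_mem_columnSet T (j := k - 1 - (j + 1)) (by omega))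
      have h2 := count_filter_succ_notMem hx (zero_mem_columnSet T (j := k - 1 - j) (by omega))
      have h3 := count_columnSet_succ_le T.1 (k - 1 - (j + 1)) (x + 1)
      rw [show k - 1 - (j + 1) + 1 = k - 1 - j by omega] at h3
      rw [peelColumns_of_lt _ _ hj, peelColumns_of_lt _ _ (by omega)]
      omega
    · rw [peelColumns_of_le _ _ hj]
      simp

/-- The tableau of shape `β` obtained from the first `k` columns of a tableau of shape
`[α, β]^k_{n+1}`. -/
noncomputable def peelTab {n k : ℕ} {α β : YoungDiagram} (hβ : β.rowLen 0 ≤ k)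
    (hlen : α.colLen 0 + β.colLen 0 ≤ n + 1) (T : RectTab n k (pairShape n k α β)) :
    BoundedTab β n :=
  ⟨ofColumns (isColumns_peelColumns hβ hlen T), lt_of_columnSet_subset fun j => by
    rw [columnSet_ofColumns]
    exact (isColumns_peelColumns hβ hlen T).subset j⟩

theorem columnSet_peelTab {n k : ℕ} {α β : YoungDiagram} (hβ : β.rowLen 0 ≤ k)
    (hlen : α.colLen 0 + β.colLen 0 ≤ n + 1) (T : RectTab n k (pairShape n k α β)) (j : ℕ) :
    columnSet (peelTab hβ hlen T).1 j = peelColumns n k (columnSet T.1) j :=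
  columnSet_ofColumns (isColumns_peelColumns hβ hlen T) j

theorem mult_peelTab {n k : ℕ} {α β : YoungDiagram} (hβ : β.rowLen 0 ≤ k)
    (hlen : α.colLen 0 + β.colLen 0 ≤ n + 1) (T : RectTab n k (pairShape n k α β)) (i : Fin n) :
    mult (peelTab hβ hlen T).1 i +
      ((Finset.range k).filter fun j => (i : ℕ) + 1 ∈ columnSet T.1 j).card = k := by
  rw [mult_eq_card_columns _ hβ]
  have h := card_columns_complement (N := n + 1) (R := k) (a := i + 1) (by omega)
    fun j hj => complementColumns_of_lt (columnSet T.1) hj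
  refine Eq.trans ?_ h
  congr 2
  refine Finset.filter_congr fun j hj => ?_
  have hj := Finset.mem_range.1 hj
  rw [columnSet_peelTab, peelColumns_of_lt _ _ hj, complementColumns_of_lt _ hj]
  simp

/-! ### Shapes whose columns past the first `k` form a row. -/

section

variable {n k m : ℕ} {β : YoungDiagram}

/-- The part of the first row of a tableau that lies to the right of its first `k` columns. -/
def rowTail {lam : YoungDiagram} (k m : ℕ) (T : SemistandardYoungTableau lam) : List ℕ :=
  (List.range m).map fun t => T 0 (k + t)

theorem length_rowTail {lam : YoungDiagram} (T : SemistandardYoungTableau lam) :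
    (rowTail k m T).length = m := by
  simp [rowTail]

theorem columnSet_rowTail (hβ : β.rowLen 0 ≤ k)
    (hlen : (rowPartition m).colLen 0 + β.colLen 0 ≤ n + 1)
    (T : RectTab n k (pairShape n k (rowPartition m) β)) (t : ℕ)
    (h : t < (rowTail k m T.1).length) : columnSet T.1 (k + t) = {(rowTail k m T.1)[t]} := by
  have ht : t < m := by rwa [length_rowTail] at h
  rw [columnSet, colLen_pairShape_add hβ hlen, colLen_rowPartition_of_lt ht]
  simp [rowTail]

theorem rowTail_pairwise (hβ : β.rowLen 0 ≤ k)
    (hlen : (rowPartition m).colLen 0 + β.colLen 0 ≤ n + 1)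
    (T : RectTab n k (pairShape n k (rowPartition m) β)) :
    (rowTail k m T.1).Pairwise (· ≤ ·) := by
  rw [rowTail, List.pairwise_map]
  refine List.Pairwise.imp_of_mem ?_ List.pairwise_lt_range
  intro a b _ hb hab
  refine T.1.row_weak (by omega) (YoungDiagram.mem_iff_lt_colLen.2 ?_)
  rw [colLen_pairShape_add hβ hlen, colLen_rowPartition_of_lt (List.mem_range.1 hb)]
  exact Nat.one_pos

theorem rowLen_pairShape_rowPartition_le :
    (pairShape n k (rowPartition m) β).rowLen 0 ≤ k + m :=
  (rowLen_zero_pairShape_le n k _ β).trans_eq (by rw [rowLen_rowPartition])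

theorem count_rowTail (hβ : β.rowLen 0 ≤ k)
    (hlen : (rowPartition m).colLen 0 + β.colLen 0 ≤ n + 1)
    (T : RectTab n k (pairShape n k (rowPartition m) β)) (a : Fin (n + 1)) :
    ((Finset.range k).filter fun j => (a : ℕ) ∈ columnSet T.1 j).card +
      (rowTail k m T.1).count (a : ℕ) = k := by
  have h1 : mult T.1 a = k := T.2.2 a
  rw [← card_columns_append_row _ (columnSet_rowTail hβ hlen T), length_rowTail,
    ← mult_eq_card_columns _ rowLen_pairShape_rowPartition_le, h1]

/-- Let `(p, q)` come from the first `k` columns and let the tail contain `t_a` letters `a`. The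
total number of free letters `i + 1` is `t_{i+1} + (q - t_i)`, with truncated subtraction. After
complementing the `k` columns, `q` counts free letters `i`, and the complements contain `t_i`
letters `i` in all; so `q ≤ t_i` and the exponent is `t_{i+1}`, the multiplicity of `i` in the
peeled tableau. -/
theorem exponent_eq_mult_peelTab (hβ : β.rowLen 0 ≤ k)
    (hlen : (rowPartition m).colLen 0 + β.colLen 0 ≤ n + 1)
    (T : RectTab n k (pairShape n k (rowPartition m) β)) (i : Fin n) :
    exponent T.1 i = mult (peelTab hβ hlen T).1 i := by
  have h1 := mult_peelTab hβ hlen T i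
  have h2 := count_rowTail hβ hlen T i.castSucc
  have h3 := count_rowTail hβ hlen T i.succ
  have h4 := (exponent_rectTab T (rowLen_pairShape_rowPartition_le (m := m)) i).2
  have h5 := bicyclicProd_append_row _ (columnSet_rowTail hβ hlen T) i
  rw [length_rowTail, wordState_of_sorted i (rowTail_pairwise hβ hlen T)] at h5
  have h6 := congrArg Prod.fst (bicyclicProd_complement (i := i) (N := n + 1) (by omega) k
    fun j hj => complementColumns_of_lt (columnSet T.1) hj)
  have h7 := bicyclicProd_columns_fst_le i k (complementColumns (n + 1) k (columnSet T.1))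
  have h8 := card_columns_complement (N := n + 1) (R := k) (a := i) (by omega)
    fun j hj => complementColumns_of_lt (columnSet T.1) hj
  simp only [Fin.val_castSucc, Fin.val_succ] at h2 h3
  rw [h5] at h4
  simp only [bicyclicMul] at h4
  simp only [Prod.fst_swap] at h6
  omega

/-- Complementing recovers the first `k` columns. The weight then fixes the content of the tail,
which is sorted and hence determined. -/
theorem peelTab_injective (hβ : β.rowLen 0 ≤ k)
    (hlen : (rowPartition m).colLen 0 + β.colLen 0 ≤ n + 1) :
    Function.Injective (peelTab (n := n) (α := rowPartition m) hβ hlen) := by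
  intro T T' h
  have h1 : ∀ j < k, columnSet T.1 j = columnSet T'.1 j := by
    intro j hj
    have h2 : columnSet (peelTab hβ hlen T).1 (k - 1 - j) =
        columnSet (peelTab hβ hlen T').1 (k - 1 - j) := by rw [h]
    rw [columnSet_peelTab, columnSet_peelTab, peelColumns_of_lt _ _ (by omega),
      peelColumns_of_lt _ _ (by omega), show k - 1 - (k - 1 - j) = j by omega] at h2
    ext x
    rcases x with _ | x
    · simp [zero_mem_columnSet T hj, zero_mem_columnSet T' hj]
    · by_cases hx : x < n
      · have h3 := Finset.ext_iff.1 h2 x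
        simp only [Finset.mem_filter, Finset.mem_range, hx, true_and] at h3
        exact not_iff_not.1 h3
      · refine iff_of_false (fun hm => ?_) fun hm => ?_
        · have := Finset.mem_range.1 (columnSet_subset T.2.1 _ hm)
          omega
        · have := Finset.mem_range.1 (columnSet_subset T'.2.1 _ hm)
          omega
  have h2 : rowTail k m T.1 = rowTail k m T'.1 := by
    refine List.Perm.eq_of_pairwise (fun a b _ _ => le_antisymm) (rowTail_pairwise hβ hlen T)
      (rowTail_pairwise hβ hlen T') (List.perm_iff_count.2 fun a => ?_)
    by_cases ha : a < n + 1
    · have h3 := count_rowTail hβ hlen T ⟨a, ha⟩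
      have h4 := count_rowTail hβ hlen T' ⟨a, ha⟩
      rw [Finset.filter_congr fun j hj => by rw [h1 j (Finset.mem_range.1 hj)]] at h3
      simp only at h3 h4
      omega
    · have key : ∀ S : RectTab n k (pairShape n k (rowPartition m) β),
          (rowTail k m S.1).count a = 0 := by
        refine fun S => List.count_eq_zero.2 fun hm => ?_
        obtain ⟨t, ht, rfl⟩ := List.getElem_of_mem hm
        have h3 := columnSet_rowTail hβ hlen S t ht
        have h4 := columnSet_subset S.2.1 (k + t)
        rw [h3, Finset.singleton_subset_iff, Finset.mem_range] at h4
        exact ha h4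
      rw [key, key]
  refine Subtype.ext (eq_of_columnSet fun j => ?_)
  rcases lt_or_ge j k with hj | hj
  · exact h1 j hj
  · obtain ⟨t, rfl⟩ := Nat.exists_eq_add_of_le hj
    rcases lt_or_ge t m with ht | ht
    · rw [columnSet_rowTail hβ hlen T t (by rwa [length_rowTail]),
        columnSet_rowTail hβ hlen T' t (by rwa [length_rowTail])]
      simp only [h2]
    · have := rowLen_pairShape_rowPartition_le (n := n) (k := k) (m := m) (β := β)
      rw [columnSet_eq_empty _ (by omega), columnSet_eq_empty _ (by omega)]

end

/-! ### Rebuilding a tableau from its peeled part. -/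

theorem count_singleton (a x : ℕ) :
    Nat.count (· ∈ ({a} : Finset ℕ)) x = if a < x then 1 else 0 := by
  induction x with
  | zero => simp
  | succ x ih =>
    rw [Nat.count_succ, ih]
    simp only [Finset.mem_singleton]
    split_ifs <;> omega

theorem count_image_succ (s : Finset ℕ) (x : ℕ) :
    Nat.count (· ∈ s.image Nat.succ) (x + 1) = Nat.count (· ∈ s) x := by
  rw [Nat.count_succ']
  simp

/-- The columns whose complements in the opposite order are the columns `C` with all letters
raised by one, followed by a row. -/
def unpeelColumns (n k : ℕ) (C : ℕ → Finset ℕ) (L : List ℕ) (j : ℕ) : Finset ℕ :=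
  if j < k then Finset.range (n + 1) \ (C (k - 1 - j)).image Nat.succ
  else L[j - k]?.toFinset

theorem unpeelColumns_of_lt (n : ℕ) {k : ℕ} (C : ℕ → Finset ℕ) (L : List ℕ) {j : ℕ} (hj : j < k) :
    unpeelColumns n k C L j = Finset.range (n + 1) \ (C (k - 1 - j)).image Nat.succ := if_pos hj

theorem unpeelColumns_add (n k : ℕ) (C : ℕ → Finset ℕ) (L : List ℕ) (t : ℕ) :
    unpeelColumns n k C L (k + t) = L[t]?.toFinset := by
  simp [unpeelColumns]

theorem unpeelColumns_add_of_lt (n k : ℕ) (C : ℕ → Finset ℕ) (L : List ℕ) (t : ℕ)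
    (h : t < L.length) : unpeelColumns n k C L (k + t) = {L[t]} := by
  rw [unpeelColumns_add, List.getElem?_eq_getElem h, Option.toFinset_some]

theorem unpeelColumns_add_of_le (n k : ℕ) (C : ℕ → Finset ℕ) (L : List ℕ) (t : ℕ)
    (h : L.length ≤ t) : unpeelColumns n k C L (k + t) = ∅ := by
  rw [unpeelColumns_add, List.getElem?_eq_none h, Option.toFinset_none]

theorem image_succ_subset {n : ℕ} {s : Finset ℕ} (hs : s ⊆ Finset.range n) :
    s.image Nat.succ ⊆ Finset.range (n + 1) := by
  intro x hx
  obtain ⟨y, hy, rfl⟩ := Finset.mem_image.1 hx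
  have := Finset.mem_range.1 (hs hy)
  exact Finset.mem_range.2 (by omega)

theorem isColumns_unpeelColumns {n k : ℕ} {β : YoungDiagram} {C : ℕ → Finset ℕ} {L : List ℕ}
    (hβ : β.rowLen 0 ≤ k) (hlen : (rowPartition L.length).colLen 0 + β.colLen 0 ≤ n + 1)
    (hC : IsColumns β n C) (hL : L.Pairwise (· ≤ ·)) (hLn : ∀ a ∈ L, a < n + 1) :
    IsColumns (pairShape n k (rowPartition L.length) β) (n + 1) (unpeelColumns n k C L) where
  subset j := by
    rcases lt_or_ge j k with hj | hj
    · rw [unpeelColumns_of_lt _ _ _ hj]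
      exact Finset.sdiff_subset
    · obtain ⟨t, rfl⟩ := Nat.exists_eq_add_of_le hj
      rcases lt_or_ge t L.length with ht | ht
      · rw [unpeelColumns_add_of_lt _ _ _ _ _ ht, Finset.singleton_subset_iff, Finset.mem_range]
        exact hLn _ (List.getElem_mem ht)
      · rw [unpeelColumns_add_of_le _ _ _ _ _ ht]
        exact Finset.empty_subset _
  card j := by
    rcases lt_or_ge j k with hj | hj
    · rw [unpeelColumns_of_lt _ _ _ hj, colLen_pairShape_of_lt hβ hlen hj,
        Finset.card_sdiff_of_subset (image_succ_subset (hC.subset _)),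
        Finset.card_image_of_injective _ Nat.succ_injective, hC.card, Finset.card_range]
    · obtain ⟨t, rfl⟩ := Nat.exists_eq_add_of_le hj
      rw [colLen_pairShape_add hβ hlen]
      rcases lt_or_ge t L.length with ht | ht
      · rw [unpeelColumns_add_of_lt _ _ _ _ _ ht, colLen_rowPartition_of_lt ht,
          Finset.card_singleton]
      · rw [unpeelColumns_add_of_le _ _ _ _ _ ht,
          colLen_eq_zero ((rowLen_rowPartition _).trans_le ht), Finset.card_empty]
  count_le j x hx := by
    rcases x with _ | x
    · simp
    rcases lt_trichotomy (j + 1) k with hj | hj | hj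
    · rw [unpeelColumns_of_lt _ _ _ hj, unpeelColumns_of_lt _ _ _ (by omega)]
      have h1 := count_sdiff hx ((C (k - 1 - (j + 1))).image Nat.succ)
      have h2 := count_sdiff hx ((C (k - 1 - j)).image Nat.succ)
      rw [count_image_succ] at h1 h2
      have h3 := hC.count_le (k - 1 - (j + 1)) x (by omega)
      rw [show k - 1 - (j + 1) + 1 = k - 1 - j by omega] at h3
      omega
    -- At the junction, the last complemented column contains `0`, because raised letters are
    -- positive. The next column has at most one entry, so the row condition is automatic.
    · have h1 : 1 ≤ Nat.count (· ∈ unpeelColumns n k C L j) (x + 1) := by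
        rw [unpeelColumns_of_lt _ _ _ (by omega), Nat.count_succ', if_pos (by simp)]
        exact Nat.le_add_left _ _
      refine le_trans ?_ h1
      rw [show j + 1 = k + 0 by omega]
      rcases lt_or_ge 0 L.length with ht | ht
      · rw [unpeelColumns_add_of_lt _ _ _ _ _ ht, count_singleton]
        split_ifs <;> omega
      · rw [unpeelColumns_add_of_le _ _ _ _ _ ht]
        simp
    · obtain ⟨t, rfl⟩ := Nat.exists_eq_add_of_le (Nat.lt_succ_iff.1 hj)
      rw [add_assoc]
      rcases lt_or_ge (t + 1) L.length with ht | ht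
      · rw [unpeelColumns_add_of_lt _ _ _ _ _ ht,
          unpeelColumns_add_of_lt _ _ _ _ t (by omega), count_singleton, count_singleton]
        have := List.pairwise_iff_getElem.1 hL t (t + 1) (by omega) ht (by omega)
        split_ifs <;> omega
      · rw [unpeelColumns_add_of_le _ _ _ _ _ ht]
        simp

theorem count_map_succ_cells {n k : ℕ} {β : YoungDiagram} (hβ : β.rowLen 0 ≤ k)
    (U : BoundedTab β n) (a : ℕ) : (β.cells.val.map fun c => U.1 c.1 c.2 + 1).count a =
      ((Finset.range k).filter fun j => a ∈ (columnSet U.1 j).image Nat.succ).card := by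
  rw [Multiset.count_map]
  rcases a with _ | a
  · rw [Finset.filter_false_of_mem (by simp), Finset.card_empty, Multiset.card_eq_zero,
      Multiset.filter_eq_nil]
    intro c _
    omega
  · have h := mult_eq_card_columns U.1 hβ a
    simp only [Finset.mem_image, Nat.succ_eq_add_one, add_left_inj, exists_eq_right]
    rw [← h, mult, Finset.card_def, Finset.filter_val]
    congr 1
    exact Multiset.filter_congr fun c _ => eq_comm

theorem peelTab_surjective {n k : ℕ} {m : ℕ} {β : YoungDiagram} (hβ : β.rowLen 0 ≤ k)
    (hlen : (rowPartition m).colLen 0 + β.colLen 0 ≤ n + 1) (hm : m = β.card) :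
    Function.Surjective (peelTab (n := n) (α := rowPartition m) hβ hlen) := by
  intro U
  -- The weight forces the tail: a letter missing from some of the first `k` columns must occur as
  -- often in the tail, and the missing letters are the entries of `U` raised by one.
  obtain ⟨L, hL, hLU⟩ : ∃ L : List ℕ, L.Pairwise (· ≤ ·) ∧
      (L : Multiset ℕ) = β.cells.val.map fun c => U.1 c.1 c.2 + 1 :=
    ⟨Multiset.sort _, Multiset.pairwise_sort _ _, Multiset.sort_eq _ _⟩
  -- The equality of weights `|α| = |β|` enters here: the forced tail has exactly the length of the
  -- row.
  have hLm : m = L.length := by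
    rw [hm, ← Multiset.coe_card, hLU, Multiset.card_map]
    rfl
  have hLn : ∀ a ∈ L, a < n + 1 := by
    intro a ha
    rw [← Multiset.mem_coe, hLU, Multiset.mem_map] at ha
    obtain ⟨c, hc, rfl⟩ := ha
    exact Nat.succ_lt_succ (U.2 c hc)
  clear hm
  subst hLm
  have hU := isColumns_columnSet U.2
  have hcols := isColumns_unpeelColumns hβ hlen hU hL hLn
  refine ⟨⟨ofColumns hcols, lt_of_columnSet_subset fun j => ?_, fun a => ?_⟩, ?_⟩
  · rw [columnSet_ofColumns]
    exact hcols.subset j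
  · rw [mult_eq_card_columns _ rowLen_pairShape_rowPartition_le]
    simp only [columnSet_ofColumns]
    rw [card_columns_append_row L (unpeelColumns_add_of_lt n k _ L), ← Multiset.coe_count, hLU,
      count_map_succ_cells hβ]
    exact card_columns_complement a.2 fun j hj => unpeelColumns_of_lt n _ L hj
  · refine Subtype.ext (eq_of_columnSet fun j => ?_)
    refine (columnSet_peelTab hβ hlen _ j).trans ?_
    rcases lt_or_ge j k with hj | hj
    · rw [peelColumns_of_lt _ _ hj, columnSet_ofColumns, unpeelColumns_of_lt _ _ _ (by omega),
        show k - 1 - (k - 1 - j) = j by omega]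
      ext x
      have : x ∈ columnSet U.1 j → x ∈ Finset.range n := fun h => hU.subset j h
      simp only [Finset.mem_range] at this
      simp only [Finset.mem_filter, Finset.mem_range, Finset.mem_sdiff, Finset.mem_image,
        Nat.succ_eq_add_one, add_left_inj, exists_eq_right, add_lt_add_iff_right]
      tauto
    · rw [peelColumns_of_le _ _ hj, columnSet_eq_empty _ (hβ.trans hj)]

theorem genExpPoly_pairShape_rowPartition {n k m : ℕ} {β : YoungDiagram} (hβ : β.rowLen 0 ≤ k)
    (hlen : (rowPartition m).colLen 0 + β.colLen 0 ≤ n + 1) (hm : m = β.card) :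
    genExpPoly n k (pairShape n k (rowPartition m) β) = schur n β :=
  Fintype.sum_bijective _ ⟨peelTab_injective hβ hlen, peelTab_surjective hβ hlen hm⟩ _ _
    fun T => Finset.prod_congr rfl fun i _ =>
      congrArg _ (exponent_eq_mult_peelTab hβ hlen T i)

end GenExp

theorem mainTheorem3 (n k : ℕ) (hk : 1 ≤ k) (α β : YoungDiagram)
    (hcard : α.card = β.card) (hβ : β.rowLen 0 ≤ k)
    (hlen : α.colLen 0 + β.colLen 0 ≤ n + 1) :
    (∀ m : ℕ, α = GenExp.rowPartition m →
      GenExp.genExpPoly n k (GenExp.pairShape n k α β) = GenExp.schur n β) ∧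
    (∀ m : ℕ, β = GenExp.rowPartition m →
      GenExp.genExpPoly n k (GenExp.pairShape n k α β) = GenExp.schur n α) ∧
    (max (α.rowLen 0) (β.rowLen 0) ≤ k →
      GenExp.genExpPoly n k (GenExp.pairShape n k α β) =
        GenExp.genExpPoly n k (GenExp.pairShape n k β α) ∧
      ∃ Φ : GenExp.RectTab n k (GenExp.pairShape n k α β) ≃
          GenExp.RectTab n k (GenExp.pairShape n k β α),
        (∀ T, GenExp.IsColumnComplement n k T.1 (Φ T).1) ∧
        (∀ T', GenExp.IsColumnComplement n k T'.1 (Φ.symm T').1) ∧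
        ∀ T, ∀ i : Fin n, GenExp.exponent (Φ T).1 i = GenExp.exponent T.1 i) := by
  have hlen' : β.colLen 0 + α.colLen 0 ≤ n + 1 := (add_comm _ _).trans_le hlen
  refine ⟨?_, ?_, fun h => ?_⟩
  · rintro m rfl
    rw [GenExp.card_rowPartition] at hcard
    exact GenExp.genExpPoly_pairShape_rowPartition hβ hlen hcard
  · rintro m rfl
    rw [GenExp.card_rowPartition] at hcard
    rw [GenExp.rowLen_rowPartition] at hβ
    -- `α_1 ≤ |α| = m ≤ k`, so the complement bijection applies and reduces this case to a row in
    -- first position.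
    have hα : α.rowLen 0 ≤ k := (GenExp.rowLen_le_card α 0).trans (hcard.trans_le hβ)
    rw [GenExp.genExpPoly_pairShape_swap hα (by rwa [GenExp.rowLen_rowPartition]) hlen]
    exact GenExp.genExpPoly_pairShape_rowPartition hα hlen' hcard.symm
  · have hα : α.rowLen 0 ≤ k := (le_max_left _ _).trans h
    exact ⟨GenExp.genExpPoly_pairShape_swap hα hβ hlen, GenExp.complementEquiv hα hβ hlen,
      GenExp.isColumnComplement_complementTab hα hβ hlen,
      GenExp.isColumnComplement_complementTab hβ hα hlen',
      GenExp.exponent_complementTab hα hβ hlen⟩
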